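/- Let $\Bbbk$ be an algebraically closed field of characteristic zero, and let $Q$ be a quiver with finitely many vertices and finitely many arrows (multiple arrows and loops allowed). Let $\Bbbk Q$ be its path algebra, with paths composed from left to right, and let $e_i$ denote the trivial path at the vertex $i$. Let $d \geq 3$, let $\sigma$ be an automorphism of the $\Bbbk$-algebra $\Bbbk Q$, and let $\omega \in \Bbbk Q$ be a $\sigma$-twisted superpotential of degree $d$, that is, a linear combination of paths of length $d$ that is invariant under the linear map acting on paths by $a_1a_2\cdots a_d \mapsto \sigma(a_d)a_1\cdots a_{d-1}$. Let $$A = \Bbbk Q/(\partial_a \omega : a \text{ an arrow of } Q)$$ be the corresponding derivation-quotient algebra, where $\partial_a$ is the linear map on $\Bbbk Q$ sending a path $a p$ to $p$ and every path not starting with $a$ to $0$. Write $A^e = A \otimes_{\Bbbk} A^{\mathrm{op}}$, and suppose that $A$ is twisted Calabi–Yau of dimension $3$ with Nakayama automorphism $\mu$, where $\mu$ is a $\Bbbk$-algebra automorphism of $A$. This means that $A$ has a finite resolution by finitely generated projective left $A^e$-modules, that $\operatorname{Ext}^i_{A^e}(A, A^e) = 0$ for $i \neq 3$, and that $\operatorname{Ext}^3_{A^e}(A,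 A^e) \cong {}^1A^{\mu}$ as right $A^e$-modules (that is, as $(A,A)$-bimodules), where ${}^1A^{\mu}$ is the invertible bimodule with underlying space $A$ and actions $b \cdot u \cdot a = b\,u\,\mu(a)$. Suppose that the Gelfand–Kirillov dimension of $A$ is finite, and that $\mu$ fixes the vertex $v$ of $Q$, that is, $\mu(e_v) = e_v$ in $A$. Then the number of loops at $v$ in $Q$ is at most $\ell(d)$, where $\ell(3) = 3$, $\ell(4) = \ell(5) = 2$, and $\ell(d) = 1$ for all $d \geq 6$. -/

import Mathlib

open Quiver CategoryTheory
open scoped TensorProduct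

noncomputable section

/-! ### Path algebras -/

/-- All paths of the quiver `V`, of all lengths and including the trivial ones. -/
abbrev AllPaths (V : Type*) [Quiver V] := Σ i j : V, Path i j

/-- The path algebra `kQ`, as a vector space: it has the set of all paths as a basis. -/
def PathAlgebra (k V : Type*) [Field k] [Quiver V] := AllPaths V →₀ k

namespace PathAlgebra

variable {k V : Type*} [Field k] [Quiver V]

instance : AddCommGroup (PathAlgebra k V) := inferInstanceAs (AddCommGroup (AllPaths V →₀ k))
instance : Module k (PathAlgebra k V) := inferInstanceAs (Module k (AllPaths V →₀ k))

/-- The basis of the path algebra consisting of all paths. -/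
def basis (k V : Type*) [Field k] [Quiver V] : Module.Basis (AllPaths V) k (PathAlgebra k V) :=
  .ofRepr (LinearEquiv.refl k (AllPaths V →₀ k))

/-- A path, as an element of the path algebra. -/
def ofPath {i j : V} (p : Path i j) : PathAlgebra k V := basis k V ⟨i, j, p⟩

/-- An arrow, as an element of the path algebra. -/
def ofArrow {i j : V} (a : i ⟶ j) : PathAlgebra k V := ofPath a.toPath

/-- The trivial path at the vertex `i`. -/
def e (i : V) : PathAlgebra k V := ofPath (Path.nil : Path i i)

theorem basis_constr_ofPath {M : Type*} [AddCommGroup M] [Module k M] (f : AllPaths V → M)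
    {i j : V} (p : Path i j) : (basis k V).constr k f (ofPath p) = f ⟨i, j, p⟩ :=
  (basis k V).constr_basis k f _

theorem induction_on {P : PathAlgebra k V → Prop} (f : PathAlgebra k V) (h0 : P 0)
    (hp : ∀ (i j : V) (p : Path i j), P (ofPath p)) (hadd : ∀ f g, P f → P g → P (f + g))
    (hsmul : ∀ (c : k) f, P f → P (c • f)) : P f := by
  have hf : f ∈ Submodule.span k (Set.range (basis k V)) := by
    rw [(basis k V).span_eq]; trivial
  induction hf using Submodule.span_induction with
  | mem x hx => obtain ⟨⟨i, j, p⟩, rfl⟩ := hx; exact hp i j p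
  | zero => exact h0
  | add x y _ _ hx hy => exact hadd x y hx hy
  | smul c x _ hx => exact hsmul c x hx

open Classical in
/-- The product of two paths, composed from left to right: `xy` if `x` ends where `y` starts,
and `0` otherwise. -/
def mulPath (x y : AllPaths V) : PathAlgebra k V :=
  if h : x.2.1 = y.1 then ofPath (x.2.2.comp (y.2.2.cast h.symm rfl)) else 0

/-- The bilinear extension of the product of paths. -/
def mulLin : PathAlgebra k V →ₗ[k] PathAlgebra k V →ₗ[k] PathAlgebra k V :=
  (basis k V).constr k fun x => (basis k V).constr k fun y => mulPath x y

instance : Mul (PathAlgebra k V) := ⟨fun f g => mulLin f g⟩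

theorem mul_def (f g : PathAlgebra k V) : f * g = mulLin f g := rfl

theorem ofPath_mul_ofPath {i j l : V} (p : Path i j) (q : Path j l) :
    (ofPath p * ofPath q : PathAlgebra k V) = ofPath (p.comp q) := by
  simp [mul_def, mulLin, basis_constr_ofPath, mulPath]

theorem ofPath_mul_ofPath_of_ne {i j j' l : V} (p : Path i j) (q : Path j' l) (h : j ≠ j') :
    (ofPath p * ofPath q : PathAlgebra k V) = 0 := by
  simp [mul_def, mulLin, basis_constr_ofPath, mulPath, h]

/-- The unit of the path algebra of a quiver with finitely many vertices: the sum of all trivial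
paths. -/
instance [Fintype V] : One (PathAlgebra k V) := ⟨∑ i : V, e i⟩

theorem one_def [Fintype V] : (1 : PathAlgebra k V) = ∑ i : V, e i := rfl

protected theorem left_distrib (f g h : PathAlgebra k V) : f * (g + h) = f * g + f * h := by
  simp [mul_def]

protected theorem right_distrib (f g h : PathAlgebra k V) : (f + g) * h = f * h + g * h := by
  simp [mul_def]

protected theorem zero_mul (f : PathAlgebra k V) : 0 * f = 0 := by simp [mul_def]

protected theorem mul_zero (f : PathAlgebra k V) : f * 0 = 0 := by simp [mul_def]

protected theorem smul_mul (c : k) (f g : PathAlgebra k V) : (c • f) * g = c • (f * g) := by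
  simp [mul_def]

protected theorem mul_smul (c : k) (f g : PathAlgebra k V) : f * (c • g) = c • (f * g) := by
  simp [mul_def]

protected theorem mul_assoc (f g h : PathAlgebra k V) : f * g * h = f * (g * h) := by
  induction f using induction_on with
  | h0 => simp only [PathAlgebra.zero_mul]
  | hadd f₁ f₂ h₁ h₂ => simp only [PathAlgebra.right_distrib, h₁, h₂]
  | hsmul c f hf => simp only [PathAlgebra.smul_mul, hf]
  | hp i j p =>
    induction g using induction_on with
    | h0 => simp only [PathAlgebra.zero_mul, PathAlgebra.mul_zero]
    | hadd f₁ f₂ h₁ h₂ => simp only [PathAlgebra.right_distrib, PathAlgebra.left_distrib, h₁, h₂]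
    | hsmul c f hf => simp only [PathAlgebra.smul_mul, PathAlgebra.mul_smul, hf]
    | hp i' j' q =>
      induction h using induction_on with
      | h0 => simp only [PathAlgebra.mul_zero]
      | hadd f₁ f₂ h₁ h₂ => simp only [PathAlgebra.left_distrib, h₁, h₂]
      | hsmul c f hf => simp only [PathAlgebra.mul_smul, hf]
      | hp i'' j'' r =>
        by_cases h₁ : j = i'
        · subst h₁
          by_cases h₂ : j' = i''
          · subst h₂
            simp only [ofPath_mul_ofPath, Path.comp_assoc]
          · rw [ofPath_mul_ofPath, ofPath_mul_ofPath_of_ne _ _ h₂, ofPath_mul_ofPath_of_ne _ _ h₂,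
              PathAlgebra.mul_zero]
        · rw [ofPath_mul_ofPath_of_ne _ _ h₁, PathAlgebra.zero_mul]
          by_cases h₂ : j' = i''
          · subst h₂
            rw [ofPath_mul_ofPath, ofPath_mul_ofPath_of_ne _ _ h₁]
          · rw [ofPath_mul_ofPath_of_ne _ _ h₂, PathAlgebra.mul_zero]

variable [Fintype V]

protected theorem one_mul (f : PathAlgebra k V) : 1 * f = f := by
  induction f using induction_on with
  | h0 => exact PathAlgebra.mul_zero _
  | hadd f₁ f₂ h₁ h₂ => rw [PathAlgebra.left_distrib, h₁, h₂]
  | hsmul c f hf => rw [PathAlgebra.mul_smul, hf]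
  | hp i j p =>
    rw [one_def, mul_def, map_sum, LinearMap.sum_apply, Finset.sum_eq_single i]
    · rw [← mul_def, e, ofPath_mul_ofPath, Path.nil_comp]
    · intro l _ hl
      rw [← mul_def, e, ofPath_mul_ofPath_of_ne _ _ hl]
    · simp

protected theorem mul_one (f : PathAlgebra k V) : f * 1 = f := by
  induction f using induction_on with
  | h0 => exact PathAlgebra.zero_mul _
  | hadd f₁ f₂ h₁ h₂ => rw [PathAlgebra.right_distrib, h₁, h₂]
  | hsmul c f hf => rw [PathAlgebra.smul_mul, hf]
  | hp i j p =>
    rw [one_def, mul_def, map_sum, Finset.sum_eq_single j]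
    · rw [← mul_def, e, ofPath_mul_ofPath, Path.comp_nil]
    · intro l _ hl
      rw [← mul_def, e, ofPath_mul_ofPath_of_ne _ _ hl.symm]
    · simp

instance : Ring (PathAlgebra k V) where
  __ := (inferInstance : AddCommGroup (PathAlgebra k V))
  left_distrib := PathAlgebra.left_distrib
  right_distrib := PathAlgebra.right_distrib
  zero_mul := PathAlgebra.zero_mul
  mul_zero := PathAlgebra.mul_zero
  mul_assoc := PathAlgebra.mul_assoc
  one_mul := PathAlgebra.one_mul
  mul_one := PathAlgebra.mul_one

instance : Algebra k (PathAlgebra k V) :=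
  Algebra.ofModule PathAlgebra.smul_mul PathAlgebra.mul_smul

end PathAlgebra

/-! ### Twisted superpotentials and derivation-quotient algebras -/

section Superpotential

variable {k V : Type*} [Field k] [Quiver V]

open Classical in
/-- The derivation operator `∂_a` of an arrow `a`: it sends a path of the form `aq` to `q`, and
every path that does not start with `a` to `0`. -/
def pathDeriv {i j : V} (a : i ⟶ j) : PathAlgebra k V →ₗ[k] PathAlgebra k V :=
  (PathAlgebra.basis k V).constr k fun x =>
    if h : ∃ (l : V) (q : Path j l), x = ⟨i, l, a.toPath.comp q⟩ then
      PathAlgebra.ofPath h.choose_spec.choose else 0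

theorem pathDeriv_ofPath {i j l : V} (a : i ⟶ j) (q : Path j l) :
    pathDeriv a (PathAlgebra.ofPath (a.toPath.comp q) : PathAlgebra k V) =
      PathAlgebra.ofPath q := by
  have h : ∃ (l' : V) (q' : Path j l'),
      (⟨i, l, a.toPath.comp q⟩ : AllPaths V) = ⟨i, l', a.toPath.comp q'⟩ := ⟨l, q, rfl⟩
  rw [pathDeriv, PathAlgebra.basis_constr_ofPath, dif_pos h]
  have key : ∀ (l' : V) (q' : Path j l'),
      (⟨i, l, a.toPath.comp q⟩ : AllPaths V) = ⟨i, l', a.toPath.comp q'⟩ →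
      (PathAlgebra.ofPath q' : PathAlgebra k V) = PathAlgebra.ofPath q := by
    intro l' q' h'
    obtain ⟨rfl, h''⟩ := Sigma.mk.inj (eq_of_heq (Sigma.mk.inj h').2)
    rw [Path.comp_injective_right _ (eq_of_heq h'')]
  exact key _ _ h.choose_spec.choose_spec

/-- The linear map that acts on paths of positive length by
`a₁a₂⋯a_d ↦ σ(a_d)a₁⋯a_{d-1}` (and fixes the trivial paths). -/
def twistedRotation [Fintype V] (σ : PathAlgebra k V ≃ₐ[k] PathAlgebra k V) :
    PathAlgebra k V →ₗ[k] PathAlgebra k V :=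
  (PathAlgebra.basis k V).constr k fun x =>
    match x with
    | ⟨i, _, .nil⟩ => PathAlgebra.e i
    | ⟨_, _, .cons p b⟩ => σ (PathAlgebra.ofArrow b) * PathAlgebra.ofPath p

/-- `ω` is homogeneous of degree `d`: a linear combination of paths of length `d`. -/
def IsHomogeneousOfDegree (ω : PathAlgebra k V) (d : ℕ) : Prop :=
  ω ∈ Submodule.span k {x | ∃ (i j : V) (p : Path i j), p.length = d ∧ x = PathAlgebra.ofPath p}

/-- `ω` is a `σ`-twisted superpotential of degree `d`. -/
structure IsTwistedSuperpotential [Fintype V] (σ : PathAlgebra k V ≃ₐ[k] PathAlgebra k V)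
    (ω : PathAlgebra k V) (d : ℕ) : Prop where
  homogeneous : IsHomogeneousOfDegree ω d
  invariant : twistedRotation σ ω = ω

/-- The two-sided ideal of the path algebra generated by the partial derivatives of `ω` at all
arrows. -/
def derivationIdeal [Fintype V] (ω : PathAlgebra k V) : TwoSidedIdeal (PathAlgebra k V) :=
  TwoSidedIdeal.span {x | ∃ (i j : V) (a : i ⟶ j), x = pathDeriv a ω}

/-- The derivation-quotient algebra `kQ / (∂_a ω : a an arrow)`. -/
abbrev DerivationQuotient [Fintype V] (ω : PathAlgebra k V) :=
  (derivationIdeal ω).ringCon.Quotient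

/-- The image in the derivation-quotient algebra of the trivial path at the vertex `i`. -/
def DerivationQuotient.e [Fintype V] (ω : PathAlgebra k V) (i : V) : DerivationQuotient ω :=
  (derivationIdeal ω).ringCon.mk' (PathAlgebra.e i)

end Superpotential

/-! ### Twisted Calabi-Yau algebras -/

section CalabiYau

universe u w

variable (k : Type u) (A : Type w) [Field k] [Ring A] [Algebra k A]

/-- The enveloping algebra `Aᵉ = A ⊗ Aᵒᵖ`. -/
abbrev Enveloping := A ⊗[k] Aᵐᵒᵖ

/-- `A` as a left module over its enveloping algebra, `(a ⊗ b) • x = a x b`. -/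
def diagonalBimodule : ModuleCat.{w} (Enveloping k A) :=
  letI : Module (Enveloping k A) A := instModuleTensorProductMop k A
  ModuleCat.of (Enveloping k A) A

theorem diagonalBimodule_smul (a b x : A) :
    letI : Module (Enveloping k A) A := instModuleTensorProductMop k A
    ((a ⊗ₜ[k] MulOpposite.op b : Enveloping k A) • x : A) = a * x * b := by
  simp [TensorProduct.Algebra.smul_def, mul_assoc]

/-- `Aᵉ` as a left module over itself. -/
abbrev envelopingModule : ModuleCat.{w} (Enveloping k A) :=
  ModuleCat.of (Enveloping k A) (Enveloping k A)

/-- `Ext^n_{Aᵉ}(A, Aᵉ)`. -/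
abbrev ExtEnveloping (n : ℕ) : Type w :=
  Abelian.Ext.{w} (diagonalBimodule k A) (envelopingModule k A) n

variable {k A}

/-- The right action of `x ∈ Aᵉ` on `Ext^n_{Aᵉ}(A, Aᵉ)`, induced by the endomorphism `y ↦ yx` of
the left module `Aᵉ`. -/
def ExtEnveloping.rightSMul {n : ℕ} (ξ : ExtEnveloping k A n) (x : Enveloping k A) :
    ExtEnveloping k A n :=
  ξ.comp (Abelian.Ext.mk₀ (ModuleCat.ofHom
    (LinearMap.toSpanSingleton (Enveloping k A) (Enveloping k A) x))) (add_zero n)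

variable (k A)

/-- `A` has a finite resolution by finitely generated projective left modules over its enveloping
algebra. -/
def IsHomologicallySmooth : Prop :=
  ∃ P : ProjectiveResolution (diagonalBimodule k A),
    (∀ i, Module.Finite (Enveloping k A) (P.complex.X i)) ∧
      ∃ n, ∀ i, n < i → Limits.IsZero (P.complex.X i)

variable {A}

/-- `A` is twisted Calabi-Yau of dimension `n`, and the automorphism `μ` of `A` is a Nakayama
automorphism of `A`: the right `Aᵉ`-module `Ext^i_{Aᵉ}(A, Aᵉ)` vanishes for `i ≠ n`, and for `i = n`
it is isomorphic to the invertible bimodule `¹A^μ` (whose inverse is `¹A^(μ⁻¹)`).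
Here `¹A^μ` is `A` with the actions `b · u · a = b u μ(a)`, and an `(A, A)`-bimodule is regarded as a
right `Aᵉ`-module by `u · (a ⊗ b) = b · u · a`. -/
structure IsTwistedCalabiYau (n : ℕ) (μ : A ≃ₐ[k] A) : Prop where
  smooth : IsHomologicallySmooth k A
  ext_eq_zero : ∀ i, i ≠ n → Subsingleton (ExtEnveloping k A i)
  ext_iso : ∃ φ : ExtEnveloping k A n ≃+ A, ∀ (ξ : ExtEnveloping k A n) (a b : A),
    φ (ξ.rightSMul (a ⊗ₜ MulOpposite.op b)) = b * φ ξ * μ a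

end CalabiYau

/-! ### Gelfand-Kirillov dimension -/

/-- The Gelfand-Kirillov dimension of the algebra `A`: the supremum, over all finite-dimensional
subspaces `W` of `A`, of the upper limits of `log dim (W⁰ + W¹ + ⋯ + Wⁿ) / log n`. -/
def gkDim (k A : Type*) [Field k] [Ring A] [Algebra k A] : EReal :=
  ⨆ (W : Submodule k A) (_ : FiniteDimensional k W),
    Filter.limsup (fun n : ℕ =>
      ((Real.log (Module.finrank k (∑ i ∈ Finset.range (n + 1), W ^ i : Submodule k A)) /
        Real.log n : ℝ) : EReal)) Filter.atTop

/-- The bound `ℓ(d)` for `d ≥ 3`: `ℓ(3) = 3`, `ℓ(4) = ℓ(5) = 2` and `ℓ(d) = 1` for `d ≥ 6`. -/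
def loopBound (d : ℕ) : ℕ :=
  if d = 3 then 3 else if d = 4 ∨ d = 5 then 2 else 1

end

/-!
Write `d = c + 2`, let `n` be the number of loops at `v`, and let `ε` be the character of `A` that
kills all arrows and all trivial paths except for `e_v`. The proof compares the number of relations
of `A` at `v` with `n`, and then plays this off against the growth of `A`.

*Relations.* Projecting the path algebra to the free algebra `T` on the loops at `v` turns the
elements `∂_a ω` into a space `R` of elements of degree `c + 1` (`vertexRelations`). A functional
on `R` extends, through the projection to degree `c + 1`, to a functional on the ideal of relations
which is a bimodule map to the one-dimensional bimodule `k_ε`; such a map gives a class in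
`Ext²_{Aᵉ}(A, k_ε)`, which is non-zero if the functional is, because relations of degree at least
two are decomposable (`exists_relationClass`). Hence `dim R ≤ dim Ext²(A, k_ε)`
(`finrank_vertexRelations_le`).

*Duality.* As `A` has projective dimension at most `3` over `Aᵉ` and `Ext³(A, Aᵉ)` is `A` twisted
by `μ`, the functor `Ext³(A, -)` is right exact, and it can be computed from `Ext³(A, Aᵉ)`. With
the dimension shift along `0 → ker → Aᵉ → k_ε → 0` and `Ext²(A, Aᵉ) = 0`, the space `Ext²(A, k_ε)`
is the kernel of `Ext³(A, ker) → Ext³(A, Aᵉ)`, which is bounded by the number of those generators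
of the left ideal `ker ε` that start at `v`, the other ones being killed because `μ` fixes `e_v`
(`IsTwistedCalabiYau.finrank_ext_le`). The generators in question are the loops at `v`, so that
`dim R ≤ n` (`IsTwistedCalabiYau.finrank_vertexRelations_le`).

*Growth.* By the argument of Golod and Shafarevich, the quotient of `T` by the ideal of `R` has
dimension at least `r ^ m` in degree `m` whenever `r ^ (c + 1) + n ≤ n r ^ c` and `r ≤ n`
(`pow_le_sub_finrank_relationIdeal`), and the subspaces of `A` spanned by products of `m` loops are
at least as large. If `n > ℓ(d)`, there is such an `r > 1` (`exists_growth_rate`), and the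
Gelfand-Kirillov dimension of `A` is infinite.
-/

noncomputable section

/-! ### Projective dimension of modules with a finite resolution -/

section ProjectiveDimension

universe w

variable {E : Type w} [Ring E]

/-- The module `X` has a resolution of length at most `n` by finitely generated projective
modules, spliced together from short exact sequences `0 → K → P → X → 0`. -/
inductive HasFiniteProjectiveResolution : ℕ → ModuleCat.{w} E → Prop
  | zero (X : ModuleCat.{w} E) [Module.Finite E X] [Projective X] :
      HasFiniteProjectiveResolution 0 X
  | succ (n : ℕ) (S : ShortComplex (ModuleCat.{w} E)) (hS : S.ShortExact)
      [Module.Finite E S.X₂] [Projective S.X₂] (h : HasFiniteProjectiveResolution n S.X₁) :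
      HasFiniteProjectiveResolution (n + 1) S.X₃

theorem HasFiniteProjectiveResolution.finite {n : ℕ} {X : ModuleCat.{w} E}
    (h : HasFiniteProjectiveResolution n X) : Module.Finite E X := by
  cases h with
  | zero => infer_instance
  | succ n S hS h => exact Module.Finite.of_surjective S.g.hom hS.moduleCat_surjective_g

theorem ext_pi_eq_zero {X : ModuleCat.{w} E} {i : ℕ}
    (h : Subsingleton (Abelian.Ext.{w} X (ModuleCat.of E E) i)) (n : ℕ)
    (e : Abelian.Ext.{w} X (ModuleCat.of E (Fin n → E)) i) : e = 0 := by
  have hid : 𝟙 (ModuleCat.of E (Fin n → E)) = ∑ j : Fin n,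
      ModuleCat.ofHom (LinearMap.proj j : (Fin n → E) →ₗ[E] E) ≫
        ModuleCat.ofHom (LinearMap.single E (fun _ : Fin n => E) j) := by
    ext x l
    simp [ModuleCat.hom_sum, Pi.single_apply]
  rw [← e.comp_mk₀_id, hid, Abelian.Ext.mk₀_sum, Abelian.Ext.comp_sum]
  refine Finset.sum_eq_zero fun j _ => ?_
  rw [← Abelian.Ext.mk₀_comp_mk₀, ← Abelian.Ext.comp_assoc_of_second_deg_zero,
    Subsingleton.elim (e.comp _ _) 0, Abelian.Ext.zero_comp]

/-- If `Ext^i(X, E)` vanishes, then so does `Ext^i(X, K)` for every finitely generated projective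
module `K`, since `K` is a direct summand of some `Eⁿ`. -/
theorem ext_eq_zero_of_finite_projective {X K : ModuleCat.{w} E} [Module.Finite E K]
    [Projective K] {i : ℕ} (h : Subsingleton (Abelian.Ext.{w} X (ModuleCat.of E E) i))
    (e : Abelian.Ext.{w} X K i) : e = 0 := by
  obtain ⟨n, f, hf⟩ := Module.Finite.exists_fin' E K
  have : Epi (ModuleCat.ofHom f) := (ModuleCat.epi_iff_surjective _).2 hf
  rw [← e.comp_mk₀_id, ← Projective.factorThru_comp (𝟙 K) (ModuleCat.ofHom f),
    ← Abelian.Ext.mk₀_comp_mk₀, ← Abelian.Ext.comp_assoc_of_second_deg_zero,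
    ext_pi_eq_zero h n (e.comp _ _), Abelian.Ext.zero_comp]

theorem projective_of_shortExact {S : ShortComplex (ModuleCat.{w} E)} (hS : S.ShortExact)
    [Projective S.X₂] (h : hS.extClass = 0) : Projective S.X₃ := by
  obtain ⟨x, hx⟩ := Abelian.Ext.covariant_sequence_exact₃ S.X₃ hS (Abelian.Ext.mk₀ (𝟙 S.X₃))
    (zero_add 1) (by rw [h, Abelian.Ext.comp_zero])
  obtain ⟨s, rfl⟩ := (Abelian.Ext.mk₀_bijective _ _).2 x
  rw [Abelian.Ext.mk₀_comp_mk₀] at hx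
  exact Retract.projective ⟨s, S.g, (Abelian.Ext.mk₀_bijective _ _).1 hx⟩

/-- A module with a finite resolution by finitely generated projectives has projective dimension at
most `m` as soon as its `Ext^i` into the ring vanishes for all `i > m`. -/
theorem HasFiniteProjectiveResolution.hasProjectiveDimensionLE {n : ℕ} {X : ModuleCat.{w} E}
    (h : HasFiniteProjectiveResolution n X) {m : ℕ}
    (hm : ∀ i, m < i → Subsingleton (Abelian.Ext.{w} X (ModuleCat.of E E) i)) :
    HasProjectiveDimensionLE X m := by
  induction h generalizing m with
  | zero X => exact hasProjectiveDimensionLT_of_ge X 1 (m + 1) (by lia)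
  | succ n S hS hn ih =>
    have shift : ∀ i, m < i + 1 → 0 < i →
        Subsingleton (Abelian.Ext.{w} S.X₁ (ModuleCat.of E E) i) := by
      intro i hi hi0
      refine subsingleton_of_forall_eq 0 fun e => ?_
      have h1 := hm (i + 1) hi
      obtain ⟨x, hx⟩ := Abelian.Ext.contravariant_sequence_exact₁ hS _ e (add_comm 1 i)
        (Subsingleton.elim _ _)
      rw [← hx, x.eq_zero_of_hasProjectiveDimensionLT 1 hi0, Abelian.Ext.comp_zero]
    cases m with
    | zero =>
      have : HasProjectiveDimensionLE S.X₁ 0 := ih fun i hi => shift i (by lia) hi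
      have : Module.Finite E S.X₁ := hn.finite
      have : Projective S.X₃ := projective_of_shortExact hS
        (ext_eq_zero_of_finite_projective (hm 1 one_pos) _)
      infer_instance
    | succ m =>
      have : HasProjectiveDimensionLE S.X₁ m := ih fun i hi => shift i (by lia) (by lia)
      exact (hS.hasProjectiveDimensionLT_X₃_iff m inferInstance).2 this

theorem HasFiniteProjectiveResolution.of_surjective {P X : Type w} [AddCommGroup P] [Module E P]
    [Module.Finite E P] [Module.Projective E P] [AddCommGroup X] [Module E X] (f : P →ₗ[E] X)
    (hf : Function.Surjective f) {n : ℕ}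
    (h : HasFiniteProjectiveResolution n (ModuleCat.of E (LinearMap.ker f))) :
    HasFiniteProjectiveResolution (n + 1) (ModuleCat.of E X) := by
  have : Module.Finite E f.shortComplexKer.X₂ := ‹Module.Finite E P›
  have : Projective f.shortComplexKer.X₂ :=
    inferInstanceAs (Projective (ModuleCat.of E P))
  exact .succ n f.shortComplexKer (LinearMap.shortExact_shortComplexKer hf) h

theorem HasFiniteProjectiveResolution.of_projectiveResolution {X : ModuleCat.{w} E}
    (P : ProjectiveResolution X) (hP : ∀ i, Module.Finite E (P.complex.X i)) {n : ℕ}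
    (hn : ∀ i, n < i → Limits.IsZero (P.complex.X i)) :
    ∃ l, HasFiniteProjectiveResolution l X := by
  have hproj : ∀ i, Module.Projective E (P.complex.X i) := fun i =>
    (IsProjective.iff_projective _).2 (P.projective i)
  have key : ∀ l j, l + j = n →
      HasFiniteProjectiveResolution l
        (ModuleCat.of E (LinearMap.range (P.complex.d (j + 1) j).hom)) := by
    intro l
    induction l with
    | zero =>
      intro j hj
      have : Subsingleton (P.complex.X (j + 1)) :=
        ModuleCat.subsingleton_of_isZero (hn _ (by lia))
      have : Subsingleton (LinearMap.range (P.complex.d (j + 1) j).hom) :=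
        (LinearMap.surjective_rangeRestrict _).subsingleton
      have := Module.Projective.of_free (R := E) (P := LinearMap.range (P.complex.d (j + 1) j).hom)
      exact .zero _
    | succ l ih =>
      intro j hj
      refine .of_surjective _ (LinearMap.surjective_rangeRestrict (P.complex.d (j + 1) j).hom) ?_
      rw [LinearMap.ker_rangeRestrict]
      have := (P.exact_succ j).moduleCat_range_eq_ker
      dsimp at this
      rw [← this]
      exact ih (j + 1) (by lia)
  refine ⟨n + 1, ?_⟩
  let f : P.complex.X 0 →ₗ[E] X := (P.π.f 0).hom
  have h0 : LinearMap.range (P.complex.d 1 0).hom = LinearMap.ker f :=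
    P.exact₀.moduleCat_range_eq_ker
  have := hP 0
  have := hproj 0
  refine .of_surjective f ((ModuleCat.epi_iff_surjective (P.π.f 0)).1 inferInstance) ?_
  rw [← h0]
  exact key n 0 rfl

end ProjectiveDimension

theorem IsTwistedCalabiYau.hasProjectiveDimensionLE {k A : Type*} [Field k] [Ring A] [Algebra k A]
    {n : ℕ} {μ : A ≃ₐ[k] A} (h : IsTwistedCalabiYau k n μ) :
    HasProjectiveDimensionLE (diagonalBimodule k A) n := by
  obtain ⟨P, hP, m, hm⟩ := h.smooth
  obtain ⟨l, hl⟩ := HasFiniteProjectiveResolution.of_projectiveResolution P hP hm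
  exact hl.hasProjectiveDimensionLE fun i hi => h.ext_eq_zero i hi.ne'

/-! ### The top `Ext` of a twisted Calabi-Yau algebra is right exact -/

section TopExt

universe u w

/-- If `X` has projective dimension at most `n`, then `Extⁿ(X, -)` is right exact, so `Extⁿ(X, M)`
is generated by the images of `Extⁿ(X, E)` under the maps `E → M` given by generators of `M`. -/
theorem ext_mem_of_span_eq_top {E : Type w} [Ring E] {X : ModuleCat.{w} E} {n : ℕ}
    [HasProjectiveDimensionLE X n] {M : Type w} [AddCommGroup M] [Module E M] {G : Set M}
    (hG : G.Finite) (hspan : Submodule.span E G = ⊤)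
    (H : AddSubgroup (Abelian.Ext.{w} X (ModuleCat.of E M) n))
    (hH : ∀ g ∈ G, ∀ ξ : Abelian.Ext.{w} X (ModuleCat.of E E) n,
      ξ.comp (Abelian.Ext.mk₀ (ModuleCat.ofHom (LinearMap.toSpanSingleton E M g)))
        (add_zero n) ∈ H)
    (η : Abelian.Ext.{w} X (ModuleCat.of E M) n) : η ∈ H := by
  obtain ⟨s, g, hg⟩ : ∃ (s : ℕ) (g : Fin s → M), Set.range g = G := by
    have := hG.to_subtype
    obtain ⟨s, ⟨e⟩⟩ := Finite.exists_equiv_fin G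
    exact ⟨s, fun i => e.symm i, by rw [← Function.comp_def, Set.range_comp]; simp⟩
  let f : (Fin s → E) →ₗ[E] M := Fintype.linearCombination E g
  have hf : Function.Surjective f := by
    rw [← LinearMap.range_eq_top, Fintype.range_linearCombination, hg, hspan]
  have hS := LinearMap.shortExact_shortComplexKer hf
  obtain ⟨ξ, hξ⟩ := Abelian.Ext.covariant_sequence_exact₃ X hS η rfl
    ((η.comp hS.extClass rfl).eq_zero_of_hasProjectiveDimensionLT (n + 1) le_rfl)
  have hid : ModuleCat.ofHom f = ∑ j : Fin s,
      ModuleCat.ofHom (LinearMap.proj j : (Fin s → E) →ₗ[E] E) ≫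
        ModuleCat.ofHom (LinearMap.toSpanSingleton E M (g j)) := by
    ext x
    simp [ModuleCat.hom_sum, f, Pi.single_apply]
  have hξ' : η = ξ.comp (Abelian.Ext.mk₀ (ModuleCat.ofHom f)) (add_zero n) := hξ.symm
  rw [hξ', hid, Abelian.Ext.mk₀_sum, Abelian.Ext.comp_sum]
  refine sum_mem fun j _ => ?_
  rw [← Abelian.Ext.mk₀_comp_mk₀, ← Abelian.Ext.comp_assoc_of_second_deg_zero]
  exact hH _ (hg ▸ Set.mem_range_self j) _

variable {k : Type u} {A : Type w} [Field k] [Ring A] [Algebra k A]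

/-- The character `ε ⊗ ε` of the enveloping algebra. -/
def envelopingCharacter (ε : A →ₐ[k] k) : Enveloping k A →ₐ[k] k :=
  Algebra.TensorProduct.lift ε (ε.fromOpposite fun _ _ => Commute.all _ _)
    fun _ _ => Commute.all _ _

@[simp]
theorem envelopingCharacter_tmul (ε : A →ₐ[k] k) (a b : A) :
    envelopingCharacter ε (a ⊗ₜ MulOpposite.op b) = ε a * ε b := by
  simp [envelopingCharacter]

/-- The kernel of the character `ε ⊗ ε`, as a left ideal of the enveloping algebra. -/
abbrev envelopingKer (ε : A →ₐ[k] k) : Submodule (Enveloping k A) (Enveloping k A) :=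
  RingHom.ker (envelopingCharacter ε)

/-- Generators of the kernel of `ε` as a left and as a right ideal give generators of the kernel of
`ε ⊗ ε`, as `a ⊗ b - ε(a) ε(b) = (1 ⊗ b) ((a - ε(a)) ⊗ 1) + ε(a) (1 ⊗ (b - ε(b)))`. -/
theorem mem_span_of_envelopingCharacter_eq_zero (ε : A →ₐ[k] k) {L R : Set A}
    (hL : ∀ x, ε x = 0 → x ∈ Submodule.span A L) (hR : ∀ x, ε x = 0 → x ∈ Submodule.span Aᵐᵒᵖ R)
    (g : Enveloping k A) (hg : envelopingCharacter ε g = 0) :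
    g ∈ Submodule.span (Enveloping k A) ((fun l : A => l ⊗ₜ[k] (1 : Aᵐᵒᵖ)) '' L ∪
      (fun r : A => (1 : A) ⊗ₜ[k] MulOpposite.op r) '' R) := by
  set S := Submodule.span (Enveloping k A) ((fun l : A => l ⊗ₜ[k] (1 : Aᵐᵒᵖ)) '' L ∪
      (fun r : A => (1 : A) ⊗ₜ[k] MulOpposite.op r) '' R)
  have h1 : ∀ x, ε x = 0 → x ⊗ₜ[k] (1 : Aᵐᵒᵖ) ∈ S := by
    intro x hx
    have hx := hL x hx
    clear * - hx
    induction hx using Submodule.span_induction with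
    | mem x h => exact Submodule.subset_span (Or.inl ⟨x, h, rfl⟩)
    | zero => simp
    | add x y _ _ h h' => rw [TensorProduct.add_tmul]; exact add_mem h h'
    | smul a x _ h => simpa using S.smul_mem (a ⊗ₜ[k] (1 : Aᵐᵒᵖ)) h
  have h2 : ∀ x, ε x = 0 → (1 : A) ⊗ₜ[k] MulOpposite.op x ∈ S := by
    intro x hx
    have hx := hR x hx
    clear * - hx
    induction hx using Submodule.span_induction with
    | mem x h => exact Submodule.subset_span (Or.inr ⟨x, h, rfl⟩)
    | zero => simp
    | add x y _ _ h h' => rw [MulOpposite.op_add, TensorProduct.tmul_add]; exact add_mem h h'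
    | smul a x _ h => simpa using S.smul_mem ((1 : A) ⊗ₜ[k] a) h
  have key : ∀ x : Enveloping k A, x - algebraMap k _ (envelopingCharacter ε x) ∈ S := by
    intro x
    induction x using TensorProduct.induction_on with
    | zero => simp
    | add x y hx hy => rw [map_add, map_add, add_sub_add_comm]; exact add_mem hx hy
    | tmul a b =>
      induction b using MulOpposite.rec' with | _ b => ?_
      have ha : (a - algebraMap k A (ε a)) ⊗ₜ[k] (1 : Aᵐᵒᵖ) =
          a ⊗ₜ[k] (1 : Aᵐᵒᵖ) - algebraMap k (Enveloping k A) (ε a) := by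
        rw [TensorProduct.sub_tmul, Algebra.TensorProduct.algebraMap_apply]
      have hb : (1 : A) ⊗ₜ[k] MulOpposite.op (b - algebraMap k A (ε b)) =
          (1 : A) ⊗ₜ[k] MulOpposite.op b - algebraMap k (Enveloping k A) (ε b) := by
        rw [MulOpposite.op_sub, TensorProduct.tmul_sub, Algebra.TensorProduct.algebraMap_apply',
          MulOpposite.algebraMap_apply]
      have hab : a ⊗ₜ[k] MulOpposite.op b =
          ((1 : A) ⊗ₜ[k] MulOpposite.op b) * (a ⊗ₜ[k] (1 : Aᵐᵒᵖ)) := by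
        simp
      have e : a ⊗ₜ[k] MulOpposite.op b -
          algebraMap k (Enveloping k A) (envelopingCharacter ε (a ⊗ₜ MulOpposite.op b)) =
          ((1 : A) ⊗ₜ[k] MulOpposite.op b) • ((a - algebraMap k A (ε a)) ⊗ₜ[k] (1 : Aᵐᵒᵖ)) +
          algebraMap k (Enveloping k A) (ε a) •
            ((1 : A) ⊗ₜ[k] MulOpposite.op (b - algebraMap k A (ε b))) := by
        rw [ha, hb, hab, ← hab, envelopingCharacter_tmul, hab, smul_eq_mul, smul_eq_mul, mul_sub,
          mul_sub, map_mul, Algebra.commutes (ε a) ((1 : A) ⊗ₜ[k] MulOpposite.op b)]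
        abel
      rw [e]
      exact add_mem (S.smul_mem _ (h1 _ (by simp))) (S.smul_mem _ (h2 _ (by simp)))
  simpa [hg] using key g

variable (k) in
/-- The right action of the enveloping algebra on the generator `1` of the bimodule `¹A^μ`:
the linear map `a ⊗ b ↦ b μ(a)`. -/
def twistedMul (μ : A ≃ₐ[k] A) : Enveloping k A →ₗ[k] A :=
  TensorProduct.lift (((LinearMap.mul k A).flip ∘ₗ μ.toLinearMap).compl₂
    (MulOpposite.opLinearEquiv k).symm.toLinearMap)

@[simp]
theorem twistedMul_tmul (μ : A ≃ₐ[k] A) (a b : A) :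
    twistedMul k μ (a ⊗ₜ MulOpposite.op b) = b * μ a := by
  simp [twistedMul]

/-- Since `Extⁿ(A, -)` is right exact with value `¹A^μ` at `Aᵉ`, its value at a finitely generated
left ideal `I` of `Aᵉ` is a quotient of `¹A^μ ⊗ I`. As `¹A^μ` is generated by `1` under the right
action, it is a quotient of `I` itself, in which the left multiplication by `a ⊗ 1` agrees with the
one by `1 ⊗ μ(a)`. -/
theorem IsTwistedCalabiYau.exists_surjective_ext {n : ℕ} {μ : A ≃ₐ[k] A}
    (h : IsTwistedCalabiYau k n μ) (I : Submodule (Enveloping k A) (Enveloping k A)) (hI : I.FG) :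
    ∃ Θ : I →ₗ[k] Abelian.Ext.{w} (diagonalBimodule k A) (ModuleCat.of (Enveloping k A) I) n,
      Function.Surjective Θ ∧
      (∀ (a : A) (g : I),
        Θ ((a ⊗ₜ[k] (1 : Aᵐᵒᵖ)) • g) = Θ (((1 : A) ⊗ₜ[k] MulOpposite.op (μ a)) • g)) ∧
      ∀ g : I, (Θ g).comp (Abelian.Ext.mk₀ (ModuleCat.ofHom I.subtype)) (add_zero n) = 0 →
        twistedMul k μ g = 0 := by
  have := h.hasProjectiveDimensionLE
  obtain ⟨φ, hφ⟩ := h.ext_iso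
  let hat (g : I) : envelopingModule k A ⟶ ModuleCat.of (Enveloping k A) I :=
    ModuleCat.ofHom (LinearMap.toSpanSingleton (Enveloping k A) I g)
  let ξ₁ := φ.symm 1
  have hat_smul (x : Enveloping k A) (g : I) :
      hat (x • g) = ModuleCat.ofHom (LinearMap.toSpanSingleton _ _ x) ≫ hat g := by
    ext; simp [hat]
  let Θ : I →ₗ[k] Abelian.Ext.{w} (diagonalBimodule k A) (ModuleCat.of (Enveloping k A) I) n :=
    { toFun g := ξ₁.comp (Abelian.Ext.mk₀ (hat g)) (add_zero n)
      map_add' g g' := by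
        have : hat (g + g') = hat g + hat g' := by ext; simp [hat]
        rw [this, Abelian.Ext.mk₀_add, Abelian.Ext.comp_add]
      map_smul' c g := by
        refine (congrArg (fun f => ξ₁.comp (Abelian.Ext.mk₀ f) (add_zero n)) ?_).trans
          ((congrArg (fun f => ξ₁.comp f (add_zero n))
            (Abelian.Ext.mk₀_smul c (hat g))).trans (Abelian.Ext.comp_smul _ _ _ c))
        ext
        change (((1 : Enveloping k A) • (c • g) : I) : Enveloping k A) =
          ((algebraMap k (Enveloping k A) c • ((1 : Enveloping k A) • g) : I) : Enveloping k A)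
        rw [one_smul, one_smul, algebraMap_smul] }
  have Θ_smul (x : Enveloping k A) (g : I) :
      Θ (x • g) = (ξ₁.rightSMul x).comp (Abelian.Ext.mk₀ (hat g)) (add_zero n) := by
    simp only [Θ, LinearMap.coe_mk, AddHom.coe_mk, hat_smul, ExtEnveloping.rightSMul]
    rw [← Abelian.Ext.mk₀_comp_mk₀, ← Abelian.Ext.comp_assoc_of_second_deg_zero]
  have hφ₁ (x : Enveloping k A) : φ (ξ₁.rightSMul x) = twistedMul k μ x := by
    induction x using TensorProduct.induction_on with
    | zero =>
      simp [ExtEnveloping.rightSMul]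
    | add x y hx hy =>
      have : ModuleCat.ofHom (LinearMap.toSpanSingleton (Enveloping k A) (Enveloping k A) (x + y)) =
          ModuleCat.ofHom (LinearMap.toSpanSingleton (Enveloping k A) (Enveloping k A) x) +
          ModuleCat.ofHom (LinearMap.toSpanSingleton (Enveloping k A) (Enveloping k A) y) := by
        ext; simp
      rw [map_add, ← hx, ← hy, ← map_add]
      simp [ExtEnveloping.rightSMul, this, Abelian.Ext.mk₀_add]
    | tmul a b =>
      induction b using MulOpposite.rec' with | _ b => ?_
      rw [hφ]
      simp [ξ₁]
  refine ⟨Θ, fun η => ?_, fun a g => ?_, fun g hg => ?_⟩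
  · obtain ⟨G, hG⟩ := hI
    have hG' : Submodule.span (Enveloping k A)
        (Subtype.val ⁻¹' (G : Set (Enveloping k A)) : Set I) = ⊤ := by
      subst hG
      exact Submodule.span_span_coe_preimage
    refine ext_mem_of_span_eq_top (G.finite_toSet.preimage Subtype.val_injective.injOn) hG'
      (LinearMap.range Θ).toAddSubgroup (fun g _ ξ => ?_) η
    refine ⟨((1 : A) ⊗ₜ[k] MulOpposite.op (φ ξ)) • g, ?_⟩
    rw [Θ_smul]
    congr 1
    apply φ.injective
    simp [hφ₁]
  · rw [Θ_smul, Θ_smul]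
    congr 1
    apply φ.injective
    simp only [hφ₁, ← MulOpposite.op_one, twistedMul_tmul]
    simp
  · have : hat g ≫ ModuleCat.ofHom I.subtype =
        ModuleCat.ofHom
          (LinearMap.toSpanSingleton (Enveloping k A) (Enveloping k A) (g : Enveloping k A)) := by
      ext; simp [hat]
    rw [← hφ₁, ← map_zero φ]
    congr 1
    rw [← hg]
    simp only [Θ, LinearMap.coe_mk, AddHom.coe_mk, ExtEnveloping.rightSMul]
    rw [Abelian.Ext.comp_assoc_of_second_deg_zero, Abelian.Ext.mk₀_comp_mk₀, this]

end TopExt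

/-! ### Duality for the one-dimensional module of a character -/

section CharacterExt

universe u w

/-- The short exact sequence `0 → I → M → M ⧸ I → 0`. -/
theorem shortExact_subtype_mkQ {E : Type w} [Ring E] {M : Type w} [AddCommGroup M] [Module E M]
    (I : Submodule E M) :
    (ShortComplex.mk (ModuleCat.ofHom I.subtype) (ModuleCat.ofHom I.mkQ)
      (by ext x; simp)).ShortExact where
  exact := (ShortComplex.ShortExact.moduleCat_exact_iff_function_exact _).mpr fun x => by
    simp
  mono_f := (ModuleCat.mono_iff_injective _).2 I.injective_subtype
  epi_g := (ModuleCat.epi_iff_surjective _).2 I.mkQ_surjective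

/-- Let `Θ` be a linear map on a left ideal `I` of a ring `E` containing two commuting copies `ιl`,
`ιr` of `A` and `Aᵐᵒᵖ`, where `I` is generated by the images of the kernel of a character `ε`. If
`Θ` does not distinguish the left multiplications by `ιl a` and `ιr (μ a)`, then all values of `Θ`
are taken at elements `ιl x + ιr y` with `x` in the `k`-span of `L₁`, provided that the kernel of
`ε` is the left ideal generated by `L₀ ∪ L₁` and the elements of `L₀` have a left support whose
image under `μ` is killed by `ε`. -/
theorem exists_reduction {k A E W : Type*} [Field k] [Ring A] [Algebra k A] [Ring E] [Algebra k E]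
    [AddCommGroup W] [Module k W] (μ : A → A) (ε : A →ₐ[k] k) (ιl : A →ₐ[k] E)
    (ιr : Aᵐᵒᵖ →ₐ[k] E) (hcomm : ∀ a b, Commute (ιl a) (ιr b)) (I : Submodule E E)
    (hl : ∀ x, ε x = 0 → ιl x ∈ I) (hr : ∀ x, ε x = 0 → ιr (MulOpposite.op x) ∈ I)
    (hE : ∀ e : E, e ∈ Submodule.span k (Set.range fun x : A × A =>
      ιl x.1 * ιr (MulOpposite.op x.2)))
    (hI : ∀ g ∈ I, g ∈ Submodule.span E (ιl '' {x | ε x = 0} ∪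
      (fun x => ιr (MulOpposite.op x)) '' {x | ε x = 0}))
    (Θ : I →ₗ[k] W) (hΘ : ∀ (a : A) (g : I), Θ (ιl a • g) = Θ (ιr (MulOpposite.op (μ a)) • g))
    {L₀ L₁ : Set A} (hε₀ : ∀ l ∈ L₀, ε l = 0) (hε₁ : ∀ l ∈ L₁, ε l = 0)
    (hL : ∀ x, ε x = 0 → x ∈ Submodule.span A (L₀ ∪ L₁))
    (hsupp : ∀ l ∈ L₀, ∃ e : A, e * l = l ∧ ε (μ e) = 0) (g : I) :
    ∃ x y : A, ∃ (_ : x ∈ Submodule.span k L₁) (_ : ε x = 0) (_ : ε y = 0)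
      (h : ιl x + ιr (MulOpposite.op y) ∈ I), Θ g = Θ ⟨_, h⟩ := by
  let 𝔪 : Submodule k A := LinearMap.ker ε.toLinearMap
  have h𝔪 (x : A) : x ∈ 𝔪 ↔ ε x = 0 := Iff.rfl
  let ℓ : 𝔪 →ₗ[k] I := LinearMap.codRestrict (I.restrictScalars k)
    (ιl.toLinearMap ∘ₗ 𝔪.subtype) fun x => hl _ x.2
  let j : 𝔪 →ₗ[k] I := LinearMap.codRestrict (I.restrictScalars k)
    (ιr.toLinearMap ∘ₗ (MulOpposite.opLinearEquiv k).toLinearMap ∘ₗ 𝔪.subtype) fun x => hr _ x.2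
  have hℓ (x : 𝔪) : (ℓ x : E) = ιl x := rfl
  have hj (x : 𝔪) : (j x : E) = ιr (MulOpposite.op (x : A)) := rfl
  let T : Submodule k I := ((Submodule.span k L₁).comap 𝔪.subtype).map ℓ ⊔ LinearMap.range j ⊔
    LinearMap.ker Θ
  have hT_congr {g g' : I} (hg : Θ g = Θ g') (hg' : g' ∈ T) : g ∈ T := by
    have : g = g' + (g - g') := by abel
    rw [this]
    exact add_mem hg' (Submodule.mem_sup_right (by rw [LinearMap.mem_ker, map_sub, hg, sub_self]))
  have hjT (y : 𝔪) : j y ∈ T :=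
    Submodule.mem_sup_left (Submodule.mem_sup_right ⟨y, rfl⟩)
  -- Left multiples of `ιr y` are congruent modulo `ker Θ` to elements `ιr y'`.
  have hmul_j (a b : A) (y : 𝔪) : (ιl a * ιr (MulOpposite.op b)) • j y ∈ T := by
    have hy : ε (y * b * μ a) = 0 := by simp [(h𝔪 _).1 y.2]
    refine hT_congr (g' := j ⟨y * b * μ a, hy⟩) ?_ (hjT _)
    rw [mul_smul, hΘ]
    congr 1
    ext
    simp [hj, ← map_mul, ← MulOpposite.op_mul, mul_assoc]
  have hmul_ℓ_ker (b x : 𝔪) : ιr (MulOpposite.op (b : A)) • ℓ x ∈ T := by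
    convert hmul_j x 1 b using 1
    ext
    simpa [hℓ, hj] using (hcomm x (MulOpposite.op (b : A))).symm.eq
  have hmul_ℓ (b : A) (x : 𝔪) (hx : ℓ x ∈ T) : ιr (MulOpposite.op b) • ℓ x ∈ T := by
    have hb : ε (b - algebraMap k A (ε b)) = 0 := by simp
    have e1 : ιr (MulOpposite.op b) • ℓ x =
        ιr (MulOpposite.op (b - algebraMap k A (ε b))) • ℓ x + ε b • ℓ x := by
      rw [← algebraMap_smul E (ε b), ← add_smul, ← ιr.commutes, MulOpposite.algebraMap_apply,
        ← map_add, ← MulOpposite.op_add, sub_add_cancel]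
    rw [e1]
    exact add_mem (hmul_ℓ_ker ⟨_, hb⟩ x) (T.smul_mem _ hx)
  have hℓT (x : A) (hx : x ∈ Submodule.span A (L₀ ∪ L₁)) : ∃ hx' : x ∈ 𝔪, ℓ ⟨x, hx'⟩ ∈ T := by
    induction hx using Submodule.span_induction with
    | mem x hx =>
      obtain hx | hx := hx
      · refine ⟨hε₀ x hx, ?_⟩
        obtain ⟨e, he, hμ⟩ := hsupp x hx
        -- `ℓ x = ιl e • ℓ x` is congruent to `ιr (μ e) • ℓ x`, and `μ e` lies in `𝔪`.
        refine hT_congr ?_ (hmul_ℓ_ker ⟨μ e, hμ⟩ ⟨x, hε₀ x hx⟩)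
        rw [← hΘ]
        congr 1
        ext
        simp [hℓ, ← map_mul, he]
      · exact ⟨hε₁ x hx, Submodule.mem_sup_left (Submodule.mem_sup_left
          ⟨⟨x, hε₁ x hx⟩, Submodule.subset_span hx, rfl⟩)⟩
    | zero => exact ⟨𝔪.zero_mem, by convert T.zero_mem using 1; exact map_zero ℓ⟩
    | add x y _ _ hx hy =>
      obtain ⟨hx, hx'⟩ := hx
      obtain ⟨hy, hy'⟩ := hy
      exact ⟨𝔪.add_mem hx hy, by simpa only [← map_add] using! add_mem hx' hy'⟩
    | smul a x _ hx =>
      obtain ⟨hx, hx'⟩ := hx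
      refine ⟨by simp [h𝔪, (h𝔪 x).1 hx], hT_congr ?_ (hmul_ℓ (μ a) _ hx')⟩
      rw [← hΘ]
      congr 1
      ext
      simp [hℓ]
  have hsmul (x : I) (hx : ∀ a b, (ιl a * ιr (MulOpposite.op b)) • x ∈ T) (e : E) : e • x ∈ T := by
    have he := hE e
    induction he using Submodule.span_induction with
    | mem e he => obtain ⟨⟨a, b⟩, rfl⟩ := he; exact hx a b
    | zero => simp
    | add e e' _ _ he he' => rw [add_smul]; exact add_mem he he'
    | smul c e _ he => rw [smul_assoc]; exact T.smul_mem c he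
  have hspan (g : E) (hg : g ∈ Submodule.span E (ιl '' {x | ε x = 0} ∪
      (fun x => ιr (MulOpposite.op x)) '' {x | ε x = 0})) :
      ∃ hg : g ∈ I, ∀ e : E, e • (⟨g, hg⟩ : I) ∈ T := by
    induction hg using Submodule.span_induction with
    | mem x hx =>
      obtain ⟨x, hx, rfl⟩ | ⟨y, hy, rfl⟩ := hx
      · refine ⟨hl x hx, hsmul (ℓ ⟨x, hx⟩) fun a b => ?_⟩
        obtain ⟨hax, hax'⟩ := hℓT (a * x) (hL _ (by simp [show ε x = 0 from hx]))
        convert hmul_ℓ b _ hax' using 1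
        ext
        simp [hℓ, (hcomm a (MulOpposite.op b)).eq, mul_assoc]
      · exact ⟨hr y hy, hsmul (j ⟨y, hy⟩) fun a b => hmul_j a b _⟩
    | zero => exact ⟨I.zero_mem, fun e => by convert T.zero_mem using 1; exact smul_zero e⟩
    | add x y _ _ hx hy =>
      obtain ⟨hx, hx'⟩ := hx
      obtain ⟨hy, hy'⟩ := hy
      exact ⟨I.add_mem hx hy, fun e => by
        simpa only [← smul_add] using! add_mem (hx' e) (hy' e)⟩
    | smul a x _ hx =>
      obtain ⟨hx, hx'⟩ := hx
      exact ⟨I.smul_mem a hx, fun e => by simpa only [mul_smul] using! hx' (e * a)⟩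
  obtain ⟨_, hT⟩ := hspan g (hI g g.2)
  have hgT : g ∈ T := by simpa using hT 1
  obtain ⟨_, hx, t, ht, rfl⟩ := Submodule.mem_sup.1 hgT
  obtain ⟨_, ⟨x, hxL, rfl⟩, _, ⟨y, rfl⟩, rfl⟩ := Submodule.mem_sup.1 hx
  refine ⟨x, y, hxL, x.2, y.2, I.add_mem (ℓ x).2 (j y).2, ?_⟩
  rw [map_add, LinearMap.mem_ker.1 ht, add_zero]
  rfl

variable {k : Type u} {A : Type w} [Field k] [Ring A] [Algebra k A]

/-- The one-dimensional `Aᵉ`-module on which both copies of `A` act by the character `ε`. -/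
abbrev characterModule (ε : A →ₐ[k] k) : ModuleCat.{w} (Enveloping k A) :=
  ModuleCat.of (Enveloping k A) (Enveloping k A ⧸ envelopingKer ε)

/-- The key dimension estimate. If the kernel of the character `ε` is generated by `L₀ ∪ L₁` as a
left ideal, then `Ext^m(A, k_ε)` has dimension at most the size of `L₁`, for `A` twisted
Calabi-Yau of dimension `m + 1`. The elements of `L₀` do not contribute, because the Nakayama
automorphism moves their left support into the kernel of `ε`. -/
theorem IsTwistedCalabiYau.finrank_ext_le {m : ℕ} {μ : A ≃ₐ[k] A}
    (h : IsTwistedCalabiYau k (m + 1) μ) (ε : A →ₐ[k] k) {L₀ L₁ R : Set A}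
    (hL₀ : L₀.Finite) (hL₁ : L₁.Finite) (hR : R.Finite)
    (hε₀ : ∀ l ∈ L₀, ε l = 0) (hε₁ : ∀ l ∈ L₁, ε l = 0) (hεR : ∀ r ∈ R, ε r = 0)
    (hL : ∀ x, ε x = 0 → x ∈ Submodule.span A (L₀ ∪ L₁))
    (hRspan : ∀ x, ε x = 0 → x ∈ Submodule.span Aᵐᵒᵖ R)
    (hsupp : ∀ l ∈ L₀, ∃ e : A, e * l = l ∧ ε (μ e) = 0) :
    Module.Finite k (Abelian.Ext.{w} (diagonalBimodule k A) (characterModule ε) m) ∧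
      Module.finrank k (Abelian.Ext.{w} (diagonalBimodule k A) (characterModule ε) m) ≤
        L₁.ncard := by
  set I := envelopingKer ε with hI
  have hmemI (g : Enveloping k A) : g ∈ I ↔ envelopingCharacter ε g = 0 := Iff.rfl
  have hl (x : A) (hx : ε x = 0) : x ⊗ₜ[k] (1 : Aᵐᵒᵖ) ∈ I := by
    rw [hmemI, ← MulOpposite.op_one, envelopingCharacter_tmul, hx, zero_mul]
  have hr (x : A) (hx : ε x = 0) : (1 : A) ⊗ₜ[k] MulOpposite.op x ∈ I := by
    rw [hmemI, envelopingCharacter_tmul, hx, mul_zero]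
  have hfg : I.FG := by
    refine Submodule.fg_def.2 ⟨(fun l : A => l ⊗ₜ[k] (1 : Aᵐᵒᵖ)) '' (L₀ ∪ L₁) ∪
      (fun r : A => (1 : A) ⊗ₜ[k] MulOpposite.op r) '' R,
      ((hL₀.union hL₁).image _).union (hR.image _), le_antisymm ?_ fun g hg =>
        mem_span_of_envelopingCharacter_eq_zero ε hL hRspan g hg⟩
    rw [Submodule.span_le]
    rintro _ (⟨l, hl' | hl', rfl⟩ | ⟨r, hr', rfl⟩)
    · exact hl l (hε₀ l hl')
    · exact hl l (hε₁ l hl')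
    · exact hr r (hεR r hr')
  obtain ⟨Θ, hΘsurj, hΘ, hΘ0⟩ := h.exists_surjective_ext I hfg
  have hred := exists_reduction μ ε (Algebra.TensorProduct.includeLeft : A →ₐ[k] Enveloping k A)
    (Algebra.TensorProduct.includeRight : Aᵐᵒᵖ →ₐ[k] Enveloping k A)
    (fun a b => by simp [Commute, SemiconjBy]) I hl hr
    (fun e => by
      induction e using TensorProduct.induction_on with
      | zero => exact zero_mem _
      | add e e' he he' => exact add_mem he he'
      | tmul a b => exact Submodule.subset_span ⟨(a, b.unop), by simp⟩)
    (mem_span_of_envelopingCharacter_eq_zero ε (fun x hx => Submodule.subset_span hx)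
      (fun x hx => Submodule.subset_span hx)) Θ hΘ hε₀ hε₁ hL hsupp
  let M₁ : Submodule k A := Submodule.span k L₁
  -- The elements `x ⊗ 1 - 1 ⊗ μ(x)`, with `x` in the span of `L₁`, account for all of the kernel of
  -- `Extᵐ⁺¹(A, I) → Extᵐ⁺¹(A, Aᵉ)`, and hence for all of `Extᵐ(A, k_ε)`.
  let Z : Submodule k A := M₁ ⊓ (LinearMap.ker ε.toLinearMap ⊓
    LinearMap.ker (ε.toLinearMap ∘ₗ μ.toLinearMap))
  have : FiniteDimensional k M₁ := FiniteDimensional.span_of_finite k hL₁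
  have hZ : Module.finrank k Z ≤ L₁.ncard := by
    refine (Submodule.finrank_mono (inf_le_left : Z ≤ M₁)).trans ?_
    have := finrank_span_finset_le_card (R := k) hL₁.toFinset
    rw [Set.ncard_eq_toFinset_card _ hL₁]
    rwa [Set.finrank, hL₁.coe_toFinset] at this
  have : FiniteDimensional k Z := Submodule.finiteDimensional_inf_left _ _
  let D : Z →ₗ[k] Abelian.Ext.{w} (diagonalBimodule k A) (ModuleCat.of (Enveloping k A) I)
      (m + 1) := Θ ∘ₗ LinearMap.codRestrict (I.restrictScalars k)
        (((TensorProduct.mk k A Aᵐᵒᵖ).flip 1 - TensorProduct.mk k A Aᵐᵒᵖ 1 ∘ₗ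
          (MulOpposite.opLinearEquiv k).toLinearMap ∘ₗ μ.toLinearMap) ∘ₗ Z.subtype)
        fun x => I.sub_mem (hl _ x.2.2.1) (hr _ x.2.2.2)
  have hS := shortExact_subtype_mkQ I
  let δ : Abelian.Ext.{w} (diagonalBimodule k A) (characterModule ε) m →ₗ[k]
      Abelian.Ext.{w} (diagonalBimodule k A) (ModuleCat.of (Enveloping k A) I) (m + 1) :=
    hS.extClass.postcompOfLinear k (diagonalBimodule k A) rfl
  have hδ_inj : Function.Injective δ := by
    rw [← LinearMap.ker_eq_bot, LinearMap.ker_eq_bot']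
    intro η hη
    obtain ⟨ξ, hξ⟩ := Abelian.Ext.covariant_sequence_exact₃ _ hS η rfl hη
    have := h.ext_eq_zero m (by simp)
    rw [← hξ, Subsingleton.elim ξ 0, Abelian.Ext.zero_comp]
  have hrange : LinearMap.range δ ≤ LinearMap.range D := by
    rintro _ ⟨η, rfl⟩
    obtain ⟨g, hg⟩ := hΘsurj (δ η)
    obtain ⟨x, y, hx, hεx, hεy, hxy, hgxy⟩ := hred g
    rw [hgxy] at hg
    have hmul := hΘ0 _ (by
      rw [hg]
      have := hS.extClass_comp
      simp only [δ, Abelian.Ext.postcompOfLinear, LinearMap.flip_apply,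
        Abelian.Ext.bilinearCompOfLinear_apply_apply]
      rw [Abelian.Ext.comp_assoc_of_third_deg_zero, this, Abelian.Ext.comp_zero])
    have hsum : μ x + y = 0 := by
      rw [map_add, Algebra.TensorProduct.includeLeft_apply,
        Algebra.TensorProduct.includeRight_apply, ← MulOpposite.op_one, twistedMul_tmul,
        twistedMul_tmul] at hmul
      simpa using hmul
    obtain rfl : y = -μ x := by rw [eq_neg_iff_add_eq_zero, add_comm, hsum]
    refine ⟨⟨x, hx, hεx, by simpa using hεy⟩, ?_⟩
    rw [← hg]
    refine congrArg Θ (Subtype.ext ?_)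
    change x ⊗ₜ[k] (1 : Aᵐᵒᵖ) - (1 : A) ⊗ₜ[k] MulOpposite.op (μ x) =
      x ⊗ₜ[k] (1 : Aᵐᵒᵖ) + (1 : A) ⊗ₜ[k] MulOpposite.op (-μ x)
    rw [MulOpposite.op_neg, TensorProduct.tmul_neg, sub_eq_add_neg]
  have hfin : FiniteDimensional k (LinearMap.range δ) :=
    Submodule.finiteDimensional_of_le hrange
  have e := LinearEquiv.ofInjective δ hδ_inj
  refine ⟨Module.Finite.equiv e.symm, ?_⟩
  rw [e.finrank_eq]
  exact (Submodule.finrank_mono hrange).trans ((LinearMap.finrank_range_le D).trans hZ)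

end CharacterExt

/-! ### Relations give classes in `Ext²` -/

section Relations

universe u w

variable {k : Type u} {Λ A : Type w} [Field k] [Ring Λ] [Algebra k Λ] [Ring A] [Algebra k A]

/-- The functionals `f` on `Λ` which, for `x ∈ Λ` and `j` in the kernel `J` of `π : Λ → A`, satisfy
`f (x j) = ε(x) f(j)` and `f (j x) = f(j) ε(x)`. Up to their values outside `J`, these are the
bimodule maps from `J` to the one-dimensional bimodule of the character `ε`. -/
def bimoduleFunctionals (π : Λ →ₐ[k] A) (ε : A →ₐ[k] k) : Submodule k (Module.Dual k Λ) where
  carrier := {f | ∀ x j, π j = 0 → f (x * j) = ε (π x) * f j ∧ f (j * x) = f j * ε (π x)}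
  zero_mem' := by simp
  add_mem' {f g} hf hg x j hj := by
    simp [(hf x j hj).1, (hf x j hj).2, (hg x j hj).1, (hg x j hj).2, mul_add, add_mul]
  smul_mem' c f hf x j hj := by
    simp [(hf x j hj).1, (hf x j hj).2, mul_assoc, mul_left_comm]

/-- The multiplication map `Aᵉ → A`. -/
def envelopingMul (k : Type u) (A : Type w) [Field k] [Ring A] [Algebra k A] :
    Enveloping k A →ₗ[Enveloping k A] diagonalBimodule k A :=
  LinearMap.toSpanSingleton (Enveloping k A) (diagonalBimodule k A) (1 : A)

theorem envelopingMul_tmul (a b : A) :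
    envelopingMul k A (a ⊗ₜ MulOpposite.op b) = (a * b : A) := by
  exact (diagonalBimodule_smul k A a b 1).trans (by rw [mul_one])

variable (k) in
/-- The universal derivation `a ⊗ 1 - 1 ⊗ a`, with values in the kernel of the multiplication. -/
def universalDerivation (a : A) : LinearMap.ker (envelopingMul k A) :=
  ⟨a ⊗ₜ 1 - 1 ⊗ₜ MulOpposite.op a, by
    rw [LinearMap.mem_ker, map_sub, ← MulOpposite.op_one, envelopingMul_tmul, envelopingMul_tmul,
      mul_one, one_mul]
    exact sub_self _⟩

/-- The free cover of the kernel of the multiplication `Aᵉ → A`, which sends the basis element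
indexed by `g ∈ Λ` to `g ⊗ 1 - 1 ⊗ g`. -/
def derivationCover (π : Λ →ₐ[k] A) :
    (Λ →₀ Enveloping k A) →ₗ[Enveloping k A] LinearMap.ker (envelopingMul k A) :=
  Finsupp.linearCombination (Enveloping k A) fun g => universalDerivation k (π g)

theorem coe_derivationCover_single (π : Λ →ₐ[k] A) (g : Λ) (t : Enveloping k A) :
    (derivationCover π (Finsupp.single g t) : Enveloping k A) =
      t * (π g ⊗ₜ 1 - 1 ⊗ₜ MulOpposite.op (π g)) := by
  simp [derivationCover, universalDerivation]

theorem derivationCover_surjective {π : Λ →ₐ[k] A} (hπ : Function.Surjective π) :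
    Function.Surjective (derivationCover π) := by
  have key (e : Enveloping k A) : ∃ τ, (derivationCover π τ : Enveloping k A) =
      e - 1 ⊗ₜ MulOpposite.op (show A from envelopingMul k A e) := by
    induction e using TensorProduct.induction_on with
    | zero => exact ⟨0, by
        rw [map_zero, map_zero]
        exact (sub_eq_zero_of_eq (TensorProduct.tmul_zero _ _).symm).symm⟩
    | add e e' he he' =>
      obtain ⟨τ, hτ⟩ := he
      obtain ⟨τ', hτ'⟩ := he'
      refine ⟨τ + τ', ?_⟩
      rw [map_add, map_add, Submodule.coe_add, hτ, hτ', sub_add_sub_comm]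
      congr 1
      exact (TensorProduct.tmul_add _ _ _).symm
    | tmul a b =>
      induction b using MulOpposite.rec' with | _ b => ?_
      obtain ⟨g, rfl⟩ := hπ a
      refine ⟨Finsupp.single g ((1 : A) ⊗ₜ[k] MulOpposite.op b), ?_⟩
      rw [coe_derivationCover_single, envelopingMul_tmul]
      simp [mul_sub]
  rintro ⟨e, he⟩
  obtain ⟨τ, hτ⟩ := key e
  refine ⟨τ, Subtype.ext ?_⟩
  rw [hτ, LinearMap.mem_ker.1 he]
  exact (congrArg (e - ·) (TensorProduct.tmul_zero _ _)).trans (sub_zero e)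

theorem smul_characterModule_eq_zero (ε : A →ₐ[k] k) {e : Enveloping k A}
    (he : envelopingCharacter ε e = 0) (x : characterModule ε) : e • x = 0 := by
  obtain ⟨x, rfl⟩ := Submodule.Quotient.mk_surjective _ x
  exact (Submodule.Quotient.mk_eq_zero _).2
    (RingHom.mem_ker.2 ((map_mul (envelopingCharacter ε) e x).trans (by rw [he, zero_mul])))

/-- A functional that is semi-invariant under `Aᵉ` for the character `ε ⊗ ε`, as a map to the
one-dimensional module of that character. -/
def liftCharacterModule (ε : A →ₐ[k] k) {K : Type w} [AddCommMonoid K] [Module (Enveloping k A) K]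
    (ψ : K →+ k) (hψ : ∀ e x, ψ (e • x) = envelopingCharacter ε e * ψ x) :
    K →ₗ[Enveloping k A] characterModule ε where
  toFun x := Submodule.Quotient.mk (algebraMap k (Enveloping k A) (ψ x))
  map_add' x y := by rw [map_add, map_add]; rfl
  map_smul' e x := by
    refine (Submodule.Quotient.eq _).2 (RingHom.mem_ker.2 ?_)
    simp [hψ, -Algebra.TensorProduct.algebraMap_apply]

theorem liftCharacterModule_eq_zero_iff (ε : A →ₐ[k] k) {K : Type w} [AddCommMonoid K]
    [Module (Enveloping k A) K] (ψ : K →+ k)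
    (hψ : ∀ e x, ψ (e • x) = envelopingCharacter ε e * ψ x) (x : K) :
    liftCharacterModule ε ψ hψ x = 0 ↔ ψ x = 0 := by
  refine (Submodule.Quotient.mk_eq_zero _).trans (RingHom.mem_ker.trans ?_)
  simp [-Algebra.TensorProduct.algebraMap_apply]

/-- The linear map `x ↦ x g - ε(g) x` on `Λ`, precomposed with a section `s` of `Λ → A` and
extended by the character `ε` to `Aᵉ`: it sends `a ⊗ b` to `ε(b) (s(a) g - ε(g) s(a))`. -/
def coverFunctionalAux (π : Λ →ₐ[k] A) (ε : A →ₐ[k] k) (s : A →ₗ[k] Λ) (g : Λ) :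
    Enveloping k A →ₗ[k] Λ :=
  TensorProduct.lift (LinearMap.flip
    ((LinearMap.lsmul k (A →ₗ[k] Λ)).flip
      ((LinearMap.mulRight k g - ε (π g) • LinearMap.id) ∘ₗ s) ∘ₗ
      (ε.toLinearMap ∘ₗ (MulOpposite.opLinearEquiv k).symm.toLinearMap)))

theorem coverFunctionalAux_tmul (π : Λ →ₐ[k] A) (ε : A →ₐ[k] k) (s : A →ₗ[k] Λ) (g : Λ)
    (a b : A) : coverFunctionalAux π ε s g (a ⊗ₜ MulOpposite.op b) =
      ε b • (s a * g - ε (π g) • s a) := by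
  simp [coverFunctionalAux]

/-- The maps `coverFunctionalAux`, assembled to a linear map on the free cover. -/
def coverFunctional (π : Λ →ₐ[k] A) (ε : A →ₐ[k] k) (s : A →ₗ[k] Λ) :
    (Λ →₀ Enveloping k A) →ₗ[k] Λ :=
  Finsupp.lsum k fun g => coverFunctionalAux π ε s g

theorem coverFunctional_single (π : Λ →ₐ[k] A) (ε : A →ₐ[k] k) (s : A →ₗ[k] Λ) (g : Λ)
    (t : Enveloping k A) :
    coverFunctional π ε s (Finsupp.single g t) = coverFunctionalAux π ε s g t := by
  simp [coverFunctional]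

/-- A functional `f` in `bimoduleFunctionals π ε` turns `coverFunctional` into a map that is
semi-invariant on the kernel of the free cover: the failure of semi-invariance at an element of the
cover depends only on its image in `Aᵉ`. -/
theorem apply_coverFunctional_smul {π : Λ →ₐ[k] A} {ε : A →ₐ[k] k} {s : A →ₗ[k] Λ}
    (hs : ∀ a, π (s a) = a) {f : Module.Dual k Λ} (hf : f ∈ bimoduleFunctionals π ε)
    (e : Enveloping k A) {τ : Λ →₀ Enveloping k A} (hτ : derivationCover π τ = 0) :
    f (coverFunctional π ε s (e • τ)) =
      envelopingCharacter ε e * f (coverFunctional π ε s τ) := by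
  induction e using TensorProduct.induction_on with
  | zero =>
    have : (0 : Enveloping k A) • τ = 0 := Finsupp.ext fun g => zero_mul (τ g)
    rw [map_zero, zero_mul, ← map_zero f, ← map_zero (coverFunctional π ε s)]
    exact congrArg (fun τ => f (coverFunctional π ε s τ)) this
  | add e e' he he' => rw [add_smul, map_add, map_add, he, he', map_add, add_mul]
  | tmul a b =>
    induction b using MulOpposite.rec' with | _ b => ?_
    -- The correction term: `x ⊗ y` is sent to `ε(y) (f(s(a) s(x)) - ε(a) f(s(x)))`.
    let H : Enveloping k A →ₗ[k] k :=
      TensorProduct.lift (LinearMap.flip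
        ((LinearMap.lsmul k (A →ₗ[k] k)).flip
          ((f ∘ₗ LinearMap.mulLeft k (s a) - ε a • f) ∘ₗ s) ∘ₗ
          (ε.toLinearMap ∘ₗ (MulOpposite.opLinearEquiv k).symm.toLinearMap)))
    have hH (x y : A) : H (x ⊗ₜ MulOpposite.op y) = ε y * (f (s a * s x) - ε a * f (s x)) := by
      simp [H]
    have hsub (x : Λ) : π (s (π x) - x) = 0 := by rw [map_sub, hs, sub_self]
    have hR (x g : Λ) : f (s (π x) * g) - ε (π g) * f (s (π x)) =
        f (x * g) - ε (π g) * f x := by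
      have := (hf g _ (hsub x)).2
      rw [sub_mul, map_sub, map_sub] at this
      linear_combination this
    have hL (c x : Λ) : f (c * s (π x)) - ε (π c) * f (s (π x)) =
        f (c * x) - ε (π c) * f x := by
      have := (hf c _ (hsub x)).1
      rw [mul_sub, map_sub, map_sub] at this
      linear_combination this
    have key (τ : Λ →₀ Enveloping k A) : f (coverFunctional π ε s
          ((a ⊗ₜ MulOpposite.op b : Enveloping k A) • τ)) =
        ε a * ε b * f (coverFunctional π ε s τ) +
          ε b * H (derivationCover π τ : Enveloping k A) := by
      induction τ using Finsupp.induction_linear with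
      | zero => simp
      | add τ τ' h h' =>
        simp only [smul_add, map_add, Submodule.coe_add, h, h']
        ring
      | single g t =>
        induction t using TensorProduct.induction_on with
        | zero => simp
        | add t t' h h' =>
          simp only [Finsupp.single_add, smul_add, map_add, Submodule.coe_add, h, h']
          ring
        | tmul x y =>
          induction y using MulOpposite.rec' with | _ y => ?_
          rw [Finsupp.smul_single, smul_eq_mul, Algebra.TensorProduct.tmul_mul_tmul,
            ← MulOpposite.op_mul, coe_derivationCover_single, coverFunctional_single,
            coverFunctional_single, coverFunctionalAux_tmul, coverFunctionalAux_tmul, mul_sub,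
            Algebra.TensorProduct.tmul_mul_tmul, Algebra.TensorProduct.tmul_mul_tmul, mul_one,
            mul_one, ← MulOpposite.op_mul, map_sub, hH, hH]
          have h1 := hR (s a * s x) g
          have h2 := hL (s a) (s x * g)
          simp only [map_mul, hs] at h1 h2
          simp only [map_smul, map_sub, map_mul, smul_eq_mul]
          rw [mul_assoc] at h1
          linear_combination (ε y * ε b) * h1 - (ε y * ε b) * h2
    rw [key, hτ, envelopingCharacter_tmul]
    simp

/-- An element of `J` that is decomposable with respect to the kernel of `ε` is, by the Leibniz
rule, the image of an element of the free cover whose coefficients are in the kernel of `ε ⊗ ε`. -/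
theorem exists_cover_of_decomposable (π : Λ →ₐ[k] A) (ε : A →ₐ[k] k) (s : A →ₗ[k] Λ)
    (hs : ∀ a, π (s a) = a) {f : Module.Dual k Λ} (hf : f ∈ bimoduleFunctionals π ε)
    (ψ : (Λ →₀ Enveloping k A) →ₗ[Enveloping k A] characterModule ε) {r : Λ}
    (hr : r ∈ Submodule.span k {z | ∃ x y, ε (π x) = 0 ∧ ε (π y) = 0 ∧ z = x * y}) :
    ∃ τ : Λ →₀ Enveloping k A,
      (derivationCover π τ : Enveloping k A) = π r ⊗ₜ 1 - 1 ⊗ₜ MulOpposite.op (π r) ∧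
      ψ τ = 0 ∧ f (coverFunctional π ε s τ) = f r := by
  induction hr using Submodule.span_induction with
  | mem r h =>
    obtain ⟨x, y, hx, hy, rfl⟩ := h
    refine ⟨Finsupp.single y (π x ⊗ₜ MulOpposite.op 1) +
      Finsupp.single x (1 ⊗ₜ MulOpposite.op (π y)), ?_, ?_, ?_⟩
    · rw [map_add, Submodule.coe_add, coe_derivationCover_single, coe_derivationCover_single]
      simp [mul_sub]
    · have h1 (g : Λ) (t : Enveloping k A) : Finsupp.single g t =
        t • Finsupp.single g (1 : Enveloping k A) := by simp
      rw [map_add, h1, h1 x, map_smul, map_smul,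
        smul_characterModule_eq_zero ε (by rw [envelopingCharacter_tmul, hx, zero_mul]),
        smul_characterModule_eq_zero ε (by rw [envelopingCharacter_tmul, hy, mul_zero]), add_zero]
    · have hsub (x : Λ) : π (s (π x) - x) = 0 := by rw [map_sub, hs, sub_self]
      have e1 := (hf y _ (hsub x)).2
      rw [sub_mul, map_sub, map_sub, hy] at e1
      rw [map_add, coverFunctional_single, coverFunctional_single, coverFunctionalAux_tmul,
        coverFunctionalAux_tmul, hx, hy]
      rw [map_one, one_smul, zero_smul, zero_smul, sub_zero, add_zero]
      linear_combination e1
  | zero => exact ⟨0, by simp, by simp, by simp⟩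
  | add x y _ _ hx hy =>
    obtain ⟨τ, h1, h2, h3⟩ := hx
    obtain ⟨τ', h1', h2', h3'⟩ := hy
    refine ⟨τ + τ', ?_, ?_, ?_⟩
    · rw [map_add, Submodule.coe_add, h1, h1', map_add, TensorProduct.add_tmul,
        MulOpposite.op_add, TensorProduct.tmul_add]
      abel
    · rw [map_add, h2, h2', add_zero]
    · rw [map_add, map_add, h3, h3', map_add]
  | smul a x _ hx =>
    obtain ⟨τ, h1, h2, h3⟩ := hx
    refine ⟨algebraMap k (Enveloping k A) a • τ, ?_, ?_, ?_⟩
    · rw [map_smul, Submodule.coe_smul, h1, algebraMap_smul, smul_sub, map_smul,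
        MulOpposite.op_smul, TensorProduct.tmul_smul, TensorProduct.smul_tmul']
    · rw [map_smul, h2, smul_zero]
    · rw [algebraMap_smul, map_smul, map_smul, h3, map_smul]

/-- Splicing two short exact sequences `0 → K → F → Ω → 0` and `0 → Ω → P → X → 0`, where `P` is
projective: a linear family of maps from `K` to `N` gives a linear family of classes in
`Ext²(X, N)`, and a class can only vanish if the map extends to `F`. -/
theorem exists_spliced_ext {C : Type*} [Category* C] [Abelian C] [Linear k C]
    [HasExt.{w} C] {X P Ω F K N : C} {i₁ : Ω ⟶ P} {p₁ : P ⟶ X} {h₁ : i₁ ≫ p₁ = 0}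
    (hS₁ : (ShortComplex.mk i₁ p₁ h₁).ShortExact) {i₂ : K ⟶ F} {p₂ : F ⟶ Ω} {h₂ : i₂ ≫ p₂ = 0}
    (hS₂ : (ShortComplex.mk i₂ p₂ h₂).ShortExact) [Projective P]
    {U : Type*} [AddCommGroup U] [Module k U] (Φ : U → (K ⟶ N))
    (hadd : ∀ f g, Φ (f + g) = Φ f + Φ g) (hsmul : ∀ (a : k) f, Φ (a • f) = a • Φ f) :
    ∃ c : U →ₗ[k] Abelian.Ext.{w} X N 2, ∀ f, c f = 0 → ∃ ψ : F ⟶ N, i₂ ≫ ψ = Φ f := by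
  let c : U →ₗ[k] Abelian.Ext.{w} X N 2 :=
    { toFun f := hS₁.extClass.comp
        (hS₂.extClass.comp (Abelian.Ext.mk₀ (Φ f)) (add_zero 1)) (rfl : 1 + 1 = 2)
      map_add' f g := by
        rw [hadd, Abelian.Ext.mk₀_add, Abelian.Ext.comp_add, Abelian.Ext.comp_add]
      map_smul' a f := by
        rw [hsmul, Abelian.Ext.mk₀_smul, Abelian.Ext.comp_smul, Abelian.Ext.comp_smul,
          RingHom.id_apply] }
  refine ⟨c, fun f hcf => ?_⟩
  obtain ⟨x, hx⟩ := Abelian.Ext.contravariant_sequence_exact₁ hS₁ _ _ (rfl : 1 + 1 = 2) hcf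
  rw [Abelian.Ext.eq_zero_of_hasProjectiveDimensionLT x 1 le_rfl, Abelian.Ext.comp_zero] at hx
  obtain ⟨y, hy⟩ := Abelian.Ext.contravariant_sequence_exact₁ hS₂ _ _ (add_zero 1) hx.symm
  obtain ⟨ψ, rfl⟩ := (Abelian.Ext.mk₀_bijective _ _).2 y
  rw [Abelian.Ext.mk₀_comp_mk₀] at hy
  exact ⟨ψ, (Abelian.Ext.mk₀_bijective _ _).1 hy⟩

/-- Let `A = Λ/J`. A functional `f` in `bimoduleFunctionals π ε` gives a class in
`Ext²(A, k_ε)`, which can only vanish if `f` vanishes on the elements of `J` that are decomposable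
with respect to the kernel of `ε`. -/
theorem exists_relationClass {π : Λ →ₐ[k] A} (hπ : Function.Surjective π) (ε : A →ₐ[k] k) :
    ∃ c : bimoduleFunctionals π ε →ₗ[k]
        Abelian.Ext.{w} (diagonalBimodule k A) (characterModule ε) 2,
      ∀ f, c f = 0 → ∀ r, π r = 0 →
        r ∈ Submodule.span k {z | ∃ x y, ε (π x) = 0 ∧ ε (π y) = 0 ∧ z = x * y} →
        (f : Module.Dual k Λ) r = 0 := by
  obtain ⟨s, hs⟩ := π.toLinearMap.exists_rightInverse_of_surjective (LinearMap.range_eq_top.2 hπ)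
  replace hs (a : A) : π (s a) = a := LinearMap.congr_fun hs a
  have hp : Function.Surjective (envelopingMul k A) := fun a =>
    ⟨(show A from a) ⊗ₜ MulOpposite.op 1,
      (envelopingMul_tmul (show A from a) 1).trans (mul_one (show A from a))⟩
  let q : ModuleCat.of (Enveloping k A) (Λ →₀ Enveloping k A) ⟶
      ModuleCat.of (Enveloping k A) (LinearMap.ker (envelopingMul k A)) :=
    ModuleCat.ofHom (derivationCover π)
  have hq : Function.Surjective q.hom := derivationCover_surjective hπ
  let Φ (f : bimoduleFunctionals π ε) :
      ModuleCat.of (Enveloping k A) (LinearMap.ker q.hom) ⟶ characterModule ε :=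
    ModuleCat.ofHom (liftCharacterModule ε
      ((f.1 ∘ₗ coverFunctional π ε s).toAddMonoidHom.comp
        (LinearMap.ker q.hom).subtype.toAddMonoidHom)
      fun e x => apply_coverFunctional_smul hs f.2 e x.2)
  obtain ⟨c, hc⟩ := exists_spliced_ext (k := k) (LinearMap.shortExact_shortComplexKer hp)
    (LinearMap.shortExact_shortComplexKer hq) Φ
    (fun f g => by
      ext x
      exact congrArg Submodule.Quotient.mk (map_add (algebraMap k (Enveloping k A)) _ _))
    (fun a f => by
      ext x
      exact congrArg Submodule.Quotient.mk (map_mul (algebraMap k (Enveloping k A)) _ _))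
  refine ⟨c, fun f hcf r hr hdec => ?_⟩
  obtain ⟨ψ, hψ⟩ := hc f hcf
  obtain ⟨τ, h1, h2, h3⟩ := exists_cover_of_decomposable π ε s hs f.2 ψ.hom hdec
  have hτ : derivationCover π τ = 0 := Subtype.ext (by
    rw [h1, hr, MulOpposite.op_zero, TensorProduct.tmul_zero, TensorProduct.zero_tmul, sub_zero]
    rfl)
  have h4 : (Φ f).hom ⟨τ, hτ⟩ = 0 :=
    (LinearMap.congr_fun (congrArg ModuleCat.Hom.hom hψ) ⟨τ, hτ⟩).symm.trans h2
  rw [← h3]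
  exact (liftCharacterModule_eq_zero_iff ε _
    (fun e x => apply_coverFunctional_smul hs f.2 e x.2) _).1 h4

end Relations

/-! ### The Golod–Shafarevich inequality -/

section GolodShafarevich

/-- A sequence with `b (m+1) ≥ n b m` for `m < c` and
`b (m+c+1) ≥ n b (m+c) - n b m` grows at least like `r ^ m`, if `r ^ (c+1) + n ≤ n r ^ c`. -/
theorem pow_le_of_recurrence {b : ℕ → ℝ} {n r : ℝ} {c : ℕ} (hr : 0 < r) (hrn : r ≤ n)
    (hn : r ^ (c + 1) + n ≤ n * r ^ c) (h0 : b 0 = 1)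
    (h1 : ∀ m < c, n * b m ≤ b (m + 1))
    (h2 : ∀ m, n * b (m + c) - n * b m ≤ b (m + c + 1)) (m : ℕ) : r ^ m ≤ b m := by
  have key : ∀ m, 0 < b m ∧ ∀ i < m, r * b i ≤ b (i + 1) := by
    intro m
    induction m with
    | zero => exact ⟨by rw [h0]; exact one_pos, by simp⟩
    | succ m ih =>
      obtain ⟨hm, hlt⟩ := ih
      have hstep : r * b m ≤ b (m + 1) := by
        rcases lt_or_ge m c with hmc | hmc
        · exact (mul_le_mul_of_nonneg_right hrn hm.le).trans (h1 m hmc)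
        · obtain ⟨a, rfl⟩ := Nat.exists_eq_add_of_le' hmc
          have hpow : ∀ j ≤ c, r ^ j * b a ≤ b (a + j) := by
            intro j
            induction j with
            | zero => simp
            | succ j ihj =>
              intro hj
              calc r ^ (j + 1) * b a = r * (r ^ j * b a) := by ring
                _ ≤ r * b (a + j) := mul_le_mul_of_nonneg_left (ihj (by omega)) hr.le
                _ ≤ b (a + (j + 1)) := hlt _ (by omega)
          have h3 : r ^ c * b a ≤ b (a + c) := hpow c le_rfl
          have hn0 : 0 ≤ n := hr.le.trans hrn
          have hrc : 0 < r ^ c := pow_pos hr c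
          refine le_trans ?_ (h2 a)
          refine le_of_mul_le_mul_left ?_ hrc
          have h4 : r ^ c * (n * b a) ≤ n * b (a + c) := by
            calc r ^ c * (n * b a) = n * (r ^ c * b a) := by ring
              _ ≤ _ := mul_le_mul_of_nonneg_left h3 hn0
          have h5 := mul_le_mul_of_nonneg_right hn hm.le
          rw [pow_succ] at h5
          linarith
      refine ⟨lt_of_lt_of_le (mul_pos hr hm) hstep, fun i hi => ?_⟩
      rcases Nat.lt_succ_iff_lt_or_eq.mp hi with hi | rfl
      · exact hlt i hi
      · exact hstep
  induction m with
  | zero => simp [h0]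
  | succ m ih =>
    calc r ^ (m + 1) = r * r ^ m := by ring
      _ ≤ r * b m := mul_le_mul_of_nonneg_left ih hr.le
      _ ≤ b (m + 1) := (key (m + 1)).2 m (Nat.lt_succ_self m)

variable {k T : Type*} [Field k] [Ring T] [Algebra k T]

theorem finrank_mul_le_mul_finrank (M N : Submodule k T) [FiniteDimensional k M]
    [FiniteDimensional k N] :
    Module.finrank k (M * N : Submodule k T) ≤ Module.finrank k M * Module.finrank k N := by
  rw [← Submodule.mulMap_range, ← Module.finrank_tensorProduct (R := k)]
  exact LinearMap.finrank_range_le _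

/-- The component of degree `m` of the two-sided ideal generated by a space `R` of elements of
degree `c + 1`, in the graded algebra whose component of degree `m` is `V ^ m`. The elements with a
factor from `V` on the right come from the previous component, and the other ones lie
in `V ^ (m - c - 1) * R`. -/
def relationIdeal (V R : Submodule k T) (c : ℕ) : ℕ → Submodule k T
  | 0 => ⊥
  | m + 1 => relationIdeal V R c m * V ⊔ if c ≤ m then V ^ (m - c) * R else ⊥

variable {V R : Submodule k T} {c : ℕ}

theorem relationIdeal_le_pow (hR : R ≤ V ^ (c + 1)) (m : ℕ) : relationIdeal V R c m ≤ V ^ m := by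
  induction m with
  | zero => exact bot_le
  | succ m ih =>
    refine sup_le ?_ ?_
    · rw [pow_succ]
      exact mul_le_mul' ih le_rfl
    · split_ifs with h
      · calc V ^ (m - c) * R ≤ V ^ (m - c) * V ^ (c + 1) := mul_le_mul' le_rfl hR
          _ = V ^ (m + 1) := by rw [← pow_add]; congr 1; omega
      · exact bot_le

theorem relationIdeal_eq_bot {m : ℕ} (hm : m ≤ c) : relationIdeal V R c m = ⊥ := by
  induction m with
  | zero => rfl
  | succ m ih =>
    rw [relationIdeal, ih (by omega), if_neg (by omega), Submodule.bot_mul, sup_bot_eq]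

theorem relationIdeal_self : relationIdeal V R c (c + 1) = R := by
  rw [relationIdeal, relationIdeal_eq_bot le_rfl, if_pos le_rfl, Submodule.bot_mul, bot_sup_eq,
    Nat.sub_self, pow_zero, one_mul]

theorem relationIdeal_mul_le (m : ℕ) : relationIdeal V R c m * V ≤ relationIdeal V R c (m + 1) :=
  le_sup_left

theorem mul_relationIdeal_le (m : ℕ) : V * relationIdeal V R c m ≤ relationIdeal V R c (m + 1) := by
  induction m with
  | zero => rw [relationIdeal_eq_bot (Nat.zero_le c), Submodule.mul_bot]; exact bot_le
  | succ m ih =>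
    rw [relationIdeal, Submodule.mul_sup]
    refine sup_le ?_ ?_
    · rw [← mul_assoc]
      exact (mul_le_mul' ih le_rfl).trans (relationIdeal_mul_le _)
    · split_ifs with h
      · refine le_trans ?_ le_sup_right
        rw [if_pos (by omega), ← mul_assoc, ← pow_succ', Nat.sub_add_comm h]
      · rw [Submodule.mul_bot]; exact bot_le

theorem relationIdeal_mul_pow_le (m j : ℕ) :
    relationIdeal V R c m * V ^ j ≤ relationIdeal V R c (m + j) := by
  induction j with
  | zero => rw [pow_zero, mul_one, add_zero]
  | succ j ih =>
    rw [pow_succ, ← mul_assoc]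
    exact (mul_le_mul' ih le_rfl).trans (relationIdeal_mul_le _)

theorem pow_mul_relationIdeal_le (m j : ℕ) :
    V ^ j * relationIdeal V R c m ≤ relationIdeal V R c (j + m) := by
  induction j with
  | zero => rw [pow_zero, one_mul, zero_add]
  | succ j ih =>
    rw [pow_succ', mul_assoc, Nat.succ_add]
    exact (mul_le_mul' le_rfl ih).trans (mul_relationIdeal_le _)

/-- Golod–Shafarevich: `n` generators and at most `n` relations of degree `c + 1` leave at least
`r ^ m` dimensions in degree `m`. The point is that `I_{m+c+1} = I_{m+c} V + C R`, where `C` is a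
complement of `I_m` in `V ^ m`, since `I_m R` is contained in `I_{m+c} V`. -/
theorem pow_le_sub_finrank_relationIdeal [FiniteDimensional k V] {n : ℕ}
    (hV : ∀ m, Module.finrank k (V ^ m : Submodule k T) = n ^ m) (hR : R ≤ V ^ (c + 1))
    (hRn : Module.finrank k R ≤ n) {r : ℝ} (hr : 0 < r) (hrn : r ≤ n)
    (hn : r ^ (c + 1) + n ≤ n * r ^ c) (m : ℕ) :
    r ^ m ≤ (n : ℝ) ^ m - Module.finrank k (relationIdeal V R c m) := by
  have hfin : ∀ m, FiniteDimensional k (V ^ m : Submodule k T) := fun m =>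
    Module.Finite.of_fg ((Module.Finite.iff_fg.mp ‹_›).pow m)
  have hle := relationIdeal_le_pow hR
  have hfinI : ∀ m, FiniteDimensional k (relationIdeal V R c m) := fun m =>
    Submodule.finiteDimensional_of_le (hle m)
  have hfinR : FiniteDimensional k R := Submodule.finiteDimensional_of_le hR
  have hV1 : Module.finrank k V = n := by
    have := hV 1
    rwa [pow_one, pow_one] at this
  refine pow_le_of_recurrence (b := fun m => (n : ℝ) ^ m - Module.finrank k (relationIdeal V R c m))
    hr hrn hn (by simp [relationIdeal_eq_bot (V := V) (R := R) (Nat.zero_le c)]) ?_ ?_ m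
  · intro m hm
    rw [relationIdeal_eq_bot (V := V) (R := R) hm.le,
      relationIdeal_eq_bot (V := V) (R := R) (Nat.succ_le_of_lt hm), finrank_bot,
      pow_succ]
    simp [mul_comm]
  · intro m
    obtain ⟨C₀, hC₀⟩ := (relationIdeal V R c m).exists_isCompl
    set C := C₀ ⊓ V ^ m with hC
    have hfinC : FiniteDimensional k C := Submodule.finiteDimensional_of_le inf_le_right
    have hsup : relationIdeal V R c m ⊔ C = V ^ m := by
      rw [hC, ← sup_inf_assoc_of_le _ (hle m), hC₀.sup_eq_top, top_inf_eq]
    have hinf : relationIdeal V R c m ⊓ C = ⊥ := by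
      rw [hC, ← inf_assoc, hC₀.inf_eq_bot, bot_inf_eq]
    have hdim := Submodule.finrank_sup_add_finrank_inf_eq (relationIdeal V R c m) C
    rw [hsup, hinf, finrank_bot, hV, add_zero] at hdim
    have hbound : relationIdeal V R c (m + c + 1) ≤ relationIdeal V R c (m + c) * V ⊔ C * R := by
      rw [relationIdeal, if_pos (Nat.le_add_left c m), Nat.add_sub_cancel]
      refine sup_le le_sup_left ?_
      rw [← hsup, Submodule.sup_mul]
      refine sup_le (le_trans ?_ le_sup_left) le_sup_right
      calc relationIdeal V R c m * R ≤ relationIdeal V R c m * V ^ (c + 1) :=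
            mul_le_mul' le_rfl hR
        _ = relationIdeal V R c m * V ^ c * V := by rw [pow_succ, mul_assoc]
        _ ≤ _ := mul_le_mul' (relationIdeal_mul_pow_le m c) le_rfl
    have hfinIV : FiniteDimensional k (relationIdeal V R c (m + c) * V : Submodule k T) :=
      Submodule.finiteDimensional_of_le ((relationIdeal_mul_le _).trans (hle _))
    have hfinCR : FiniteDimensional k (C * R : Submodule k T) :=
      Module.Finite.of_fg ((Module.Finite.iff_fg.mp hfinC).mul (Module.Finite.iff_fg.mp hfinR))
    have h1 : Module.finrank k (relationIdeal V R c (m + c + 1)) ≤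
        Module.finrank k (relationIdeal V R c (m + c)) * n + Module.finrank k C * n := by
      calc _ ≤ _ := Submodule.finrank_mono hbound
        _ ≤ _ := Submodule.finrank_add_le_finrank_add_finrank _ _
        _ ≤ _ := add_le_add (finrank_mul_le_mul_finrank _ _) (finrank_mul_le_mul_finrank _ _)
        _ ≤ _ := by rw [hV1]; gcongr
    have h1' : (Module.finrank k (relationIdeal V R c (m + c + 1)) : ℝ) ≤
        Module.finrank k (relationIdeal V R c (m + c)) * n + Module.finrank k C * n := by
      exact_mod_cast h1
    have h2' : (n : ℝ) ^ m = Module.finrank k (relationIdeal V R c m) + Module.finrank k C := by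
      exact_mod_cast hdim
    simp only [h2']
    rw [pow_succ]
    linarith

end GolodShafarevich

/-! ### Graded ideals of the free algebra -/

section FreeAlgebra

variable (k X : Type*) [Field k]

/-- The free algebra on `X`, as the monoid algebra of the free monoid, which has the words in `X`
as a basis. -/
abbrev WordAlgebra := MonoidAlgebra k (FreeMonoid X)

/-- The space spanned by the letters in the free algebra. -/
def letterSpan : Submodule k (WordAlgebra k X) :=
  Submodule.span k (Set.range fun x : X => MonoidAlgebra.of k (FreeMonoid X) (FreeMonoid.of x))

theorem letterSpan_pow (m : ℕ) : letterSpan k X ^ m =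
    Submodule.span k (Set.range fun w : List.Vector X m =>
      MonoidAlgebra.of k (FreeMonoid X) (FreeMonoid.ofList w.1)) := by
  induction m with
  | zero =>
    rw [pow_zero, Submodule.one_eq_span]
    congr 1
    ext x
    simp only [Set.mem_singleton_iff, Set.mem_range]
    constructor
    · rintro rfl
      exact ⟨List.Vector.nil, map_one _⟩
    · rintro ⟨w, rfl⟩
      rw [List.Vector.eq_nil w]
      exact map_one _
  | succ m ih =>
    rw [pow_succ', ih, letterSpan, Submodule.span_mul_span]
    congr 1
    ext x
    constructor
    · rintro ⟨_, ⟨y, rfl⟩, _, ⟨w, rfl⟩, rfl⟩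
      exact ⟨y ::ᵥ w, by simp only [← map_mul]; rfl⟩
    · rintro ⟨w, rfl⟩
      refine ⟨_, ⟨w.head, rfl⟩, _, ⟨w.tail, rfl⟩, ?_⟩
      simp only [← map_mul]
      congr 1
      conv_rhs => rw [← List.Vector.cons_head_tail w]
      rfl

theorem of_mem_letterSpan_pow (w : FreeMonoid X) :
    MonoidAlgebra.of k (FreeMonoid X) w ∈ letterSpan k X ^ w.length := by
  rw [letterSpan_pow]
  exact Submodule.subset_span ⟨⟨w.toList, rfl⟩, rfl⟩

instance [Finite X] : FiniteDimensional k (letterSpan k X) :=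
  FiniteDimensional.span_of_finite k (Set.finite_range _)

theorem finrank_letterSpan_pow [Finite X] (m : ℕ) :
    Module.finrank k (letterSpan k X ^ m : Submodule k (WordAlgebra k X)) = Nat.card X ^ m := by
  have := Fintype.ofFinite X
  rw [letterSpan_pow, finrank_span_eq_card, card_vector, Nat.card_eq_fintype_card]
  exact (MonoidAlgebra.basis (FreeMonoid X) k).linearIndependent.comp
    (fun w : List.Vector X m => FreeMonoid.ofList w.1)
    (FreeMonoid.ofList.injective.comp Subtype.val_injective)

/-- The projection of the free algebra onto its component of degree `m`. -/
def degreePart (m : ℕ) : WordAlgebra k X →ₗ[k] WordAlgebra k X :=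
  (MonoidAlgebra.basis (FreeMonoid X) k).constr k fun w =>
    if w.length = m then MonoidAlgebra.of k (FreeMonoid X) w else 0

theorem degreePart_of (m : ℕ) (w : FreeMonoid X) :
    degreePart k X m (MonoidAlgebra.of k (FreeMonoid X) w) =
      if w.length = m then MonoidAlgebra.of k (FreeMonoid X) w else 0 :=
  (MonoidAlgebra.basis (FreeMonoid X) k).constr_basis k _ w

variable {k X}

theorem degreePart_of_mem {j : ℕ} {t : WordAlgebra k X} (ht : t ∈ letterSpan k X ^ j) (m : ℕ) :
    degreePart k X m t = if j = m then t else 0 := by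
  rw [letterSpan_pow] at ht
  induction ht using Submodule.span_induction with
  | mem x hx =>
    obtain ⟨w, rfl⟩ := hx
    have hw : (FreeMonoid.ofList w.1).length = j := w.2
    rw [degreePart_of, hw]
  | zero => simp
  | add x y _ _ hx hy => rw [map_add, hx, hy]; split_ifs <;> simp
  | smul c x _ hx => rw [map_smul, hx]; split_ifs <;> simp

variable (k X) in
/-- The augmentation of the free algebra, which sends all letters to zero. -/
def wordAugmentation : WordAlgebra k X →ₐ[k] k :=
  MonoidAlgebra.lift k k (FreeMonoid X) (FreeMonoid.lift fun _ => 0)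

theorem wordAugmentation_of_mem_letterSpan {t : WordAlgebra k X} (ht : t ∈ letterSpan k X) :
    wordAugmentation k X t = 0 := by
  induction ht using Submodule.span_induction with
  | mem x hx =>
    obtain ⟨y, rfl⟩ := hx
    rw [wordAugmentation, MonoidAlgebra.lift_of, FreeMonoid.lift_eval_of]
  | zero => simp
  | add x y _ _ hx hy => simp [hx, hy]
  | smul c x _ hx => simp [hx]

theorem wordAugmentation_of_mem_pow {j : ℕ} (hj : j ≠ 0) {t : WordAlgebra k X}
    (ht : t ∈ letterSpan k X ^ j) : wordAugmentation k X t = 0 := by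
  obtain ⟨j, rfl⟩ := Nat.exists_eq_succ_of_ne_zero hj
  rw [pow_succ'] at ht
  induction ht using Submodule.mul_induction_on' with
  | mem_mul_mem x hx y _ => rw [map_mul, wordAugmentation_of_mem_letterSpan hx, zero_mul]
  | add x _ y _ hx hy => simp [hx, hy]

variable (R : Submodule k (WordAlgebra k X)) (c : ℕ)

/-- The two-sided ideal generated by a space `R` of elements of degree `c + 1`. -/
def wordIdeal : Submodule k (WordAlgebra k X) := ⨆ m, relationIdeal (letterSpan k X) R c m

variable {R c}

theorem le_wordIdeal : R ≤ wordIdeal R c := fun x hx =>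
  Submodule.mem_iSup_of_mem (c + 1) (by rwa [relationIdeal_self])

theorem mul_mem_wordIdeal (t : WordAlgebra k X) {i : WordAlgebra k X} (hi : i ∈ wordIdeal R c) :
    t * i ∈ wordIdeal R c ∧ i * t ∈ wordIdeal R c := by
  induction t using MonoidAlgebra.induction_on with
  | of w =>
    induction hi using Submodule.iSup_induction' with
    | mem m i hi =>
      exact ⟨Submodule.mem_iSup_of_mem _ (pow_mul_relationIdeal_le m _
          (Submodule.mul_mem_mul (of_mem_letterSpan_pow k X w) hi)),
        Submodule.mem_iSup_of_mem _ (relationIdeal_mul_pow_le m _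
          (Submodule.mul_mem_mul hi (of_mem_letterSpan_pow k X w)))⟩
    | zero => simp
    | add x y _ _ hx hy =>
      rw [mul_add, add_mul]
      exact ⟨add_mem hx.1 hy.1, add_mem hx.2 hy.2⟩
  | add x y hx hy =>
    rw [mul_add, add_mul]
    exact ⟨add_mem hx.1 hy.1, add_mem hx.2 hy.2⟩
  | smul r x hx =>
    rw [mul_smul_comm, smul_mul_assoc]
    exact ⟨Submodule.smul_mem _ _ hx.1, Submodule.smul_mem _ _ hx.2⟩

theorem degreePart_mem_relationIdeal (hR : R ≤ letterSpan k X ^ (c + 1)) {i : WordAlgebra k X}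
    (hi : i ∈ wordIdeal R c) (m : ℕ) :
    degreePart k X m i ∈ relationIdeal (letterSpan k X) R c m := by
  induction hi using Submodule.iSup_induction' with
  | mem l i hi =>
    rw [degreePart_of_mem (relationIdeal_le_pow hR l hi)]
    split_ifs with h
    · exact h ▸ hi
    · exact zero_mem _
  | zero => rw [map_zero]; exact zero_mem _
  | add x y _ _ hx hy => rw [map_add]; exact add_mem hx hy

/-- The component of an element of the ideal in the degree of the relations transforms under
multiplication through the augmentation, since the ideal has no components of lower degree. -/
theorem degreePart_mul (hR : R ≤ letterSpan k X ^ (c + 1)) (t : WordAlgebra k X)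
    {i : WordAlgebra k X} (hi : i ∈ wordIdeal R c) :
    degreePart k X (c + 1) (t * i) = wordAugmentation k X t • degreePart k X (c + 1) i ∧
      degreePart k X (c + 1) (i * t) = wordAugmentation k X t • degreePart k X (c + 1) i := by
  induction t using MonoidAlgebra.induction_on with
  | of w =>
    induction hi using Submodule.iSup_induction' with
    | mem m i hi =>
      have hw := of_mem_letterSpan_pow k X w
      have hl := relationIdeal_le_pow hR _
        (pow_mul_relationIdeal_le m _ (Submodule.mul_mem_mul hw hi))
      have hr := relationIdeal_le_pow hR _
        (relationIdeal_mul_pow_le m _ (Submodule.mul_mem_mul hi hw))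
      by_cases h0 : w.length = 0
      · rw [FreeMonoid.length_eq_zero.mp h0, map_one, map_one, one_mul, mul_one, one_smul]
        exact ⟨rfl, rfl⟩
      · -- Both sides vanish: in degree `c + 1`, a word of positive length leaves for `i` a degree
        -- `m ≤ c`, in which the ideal is zero.
        rw [degreePart_of_mem hl, degreePart_of_mem hr, wordAugmentation_of_mem_pow h0 hw]
        split_ifs with h1 h2 h2
        · rw [relationIdeal_eq_bot (by omega), Submodule.mem_bot] at hi
          simp [hi]
        · omega
        · omega
        · simp
    | zero => simp
    | add x y _ _ hx hy =>
      simp only [mul_add, add_mul, map_add, hx.1, hx.2, hy.1, hy.2, smul_add, and_self]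
  | add x y hx hy =>
    simp only [mul_add, add_mul, map_add, hx.1, hx.2, hy.1, hy.2, add_smul, and_self]
  | smul r x hx =>
    simp only [mul_smul_comm, smul_mul_assoc, map_smul, hx.1, hx.2, smul_assoc, and_self]

end FreeAlgebra

/-! ### Reading the loops at a vertex -/

section Loops

variable (k : Type*) {V : Type*} [Field k] [Quiver V]

open Classical in
/-- The letter of a loop at `v`, and zero for all other arrows. -/
def loopLetter (v : V) {i j : V} (a : i ⟶ j) : WordAlgebra k (v ⟶ v) :=
  if h : i = v ∧ j = v then MonoidAlgebra.of k _ (FreeMonoid.of (a.cast h.1 h.2)) else 0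

open Classical in
/-- The word of a path that consists of loops at `v`, and zero for all other paths. -/
def loopWord (v : V) : ∀ {i j : V}, Path i j → WordAlgebra k (v ⟶ v)
  | i, _, .nil => if i = v then 1 else 0
  | _, _, .cons p a => loopWord v p * loopLetter k v a

variable {k} {v : V}

theorem loopLetter_loop (a : v ⟶ v) :
    loopLetter k v a = MonoidAlgebra.of k _ (FreeMonoid.of a) := by
  simp [loopLetter]

theorem loopLetter_mem {i j : V} (a : i ⟶ j) : loopLetter k v a ∈ letterSpan k (v ⟶ v) := by
  unfold loopLetter
  split_ifs
  · exact Submodule.subset_span ⟨_, rfl⟩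
  · exact zero_mem _

theorem loopWord_mem {i j : V} (p : Path i j) :
    loopWord k v p ∈ letterSpan k (v ⟶ v) ^ p.length := by
  induction p with
  | nil =>
    rw [loopWord, Path.length_nil, pow_zero]
    split_ifs
    · exact Submodule.one_le.mp le_rfl
    · exact zero_mem _
  | cons p a ih =>
    rw [loopWord, Path.length_cons, pow_succ]
    exact Submodule.mul_mem_mul ih (loopLetter_mem a)

theorem loopWord_mul_nil {i j : V} (p : Path i j) :
    loopWord k v p * loopWord k v (Path.nil : Path j j) = loopWord k v p := by
  cases p with
  | nil => simp [loopWord]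
  | @cons j _ p a =>
    rw [loopWord, loopWord, mul_assoc]
    congr 1
    split_ifs with h
    · rw [mul_one]
    · rw [mul_zero, loopLetter, dif_neg (fun h' => h h'.2)]

theorem loopWord_comp {i j l : V} (p : Path i j) (q : Path j l) :
    loopWord k v (p.comp q) = loopWord k v p * loopWord k v q := by
  induction q with
  | nil => rw [Path.comp_nil, loopWord_mul_nil]
  | cons q a ih => rw [Path.comp_cons, loopWord, ih, loopWord, mul_assoc]

theorem loopWord_mul_of_ne {i j j' l : V} (p : Path i j) (q : Path j' l) (h : j ≠ j') :
    loopWord k v p * loopWord k v q = 0 := by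
  have h0 : loopWord k v (Path.nil : Path j j) * loopWord k v (Path.nil : Path j' j') = 0 := by
    simp only [loopWord]
    split_ifs with h1 h2 <;> simp_all
  rw [← loopWord_mul_nil p, ← Path.nil_comp q, loopWord_comp, mul_assoc,
    ← mul_assoc _ _ (loopWord k v q),
    h0, zero_mul, mul_zero]

variable [Fintype V]

variable (k v) in
/-- The projection of the path algebra to the free algebra on the loops at `v`, which kills all
arrows except for these loops, and all trivial paths except for the one at `v`. -/
def loopProjection : PathAlgebra k V →ₐ[k] WordAlgebra k (v ⟶ v) :=
  AlgHom.ofLinearMap ((PathAlgebra.basis k V).constr k fun x => loopWord k v x.2.2)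
    (by
      rw [PathAlgebra.one_def, map_sum, Finset.sum_eq_single v]
      · rw [PathAlgebra.e, PathAlgebra.basis_constr_ofPath, loopWord, if_pos rfl]
      · intro i _ hi
        rw [PathAlgebra.e, PathAlgebra.basis_constr_ofPath, loopWord, if_neg hi]
      · simp)
    (by
      intro f g
      induction f using PathAlgebra.induction_on with
      | h0 => simp
      | hadd f₁ f₂ h₁ h₂ => simp only [add_mul, map_add, h₁, h₂]
      | hsmul c f hf => simp only [smul_mul_assoc, map_smul, hf]
      | hp i j p =>
        induction g using PathAlgebra.induction_on with
        | h0 => simp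
        | hadd f₁ f₂ h₁ h₂ => simp only [mul_add, map_add, h₁, h₂]
        | hsmul c f hf => simp only [mul_smul_comm, map_smul, hf]
        | hp j' l q =>
          simp only [PathAlgebra.basis_constr_ofPath]
          by_cases h : j = j'
          · subst h
            rw [PathAlgebra.ofPath_mul_ofPath, PathAlgebra.basis_constr_ofPath, loopWord_comp]
          · rw [PathAlgebra.ofPath_mul_ofPath_of_ne _ _ h, map_zero, loopWord_mul_of_ne _ _ h])

theorem loopProjection_ofPath {i j : V} (p : Path i j) :
    loopProjection k v (PathAlgebra.ofPath p) = loopWord k v p :=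
  PathAlgebra.basis_constr_ofPath _ p

theorem loopProjection_ofArrow (a : v ⟶ v) : loopProjection k v (PathAlgebra.ofArrow a) =
    MonoidAlgebra.of k _ (FreeMonoid.of a) := by
  rw [PathAlgebra.ofArrow, loopProjection_ofPath, Hom.toPath, loopWord, loopWord, if_pos rfl,
    one_mul, loopLetter_loop]

theorem IsHomogeneousOfDegree.loopProjection_mem {f : PathAlgebra k V} {m : ℕ}
    (hf : IsHomogeneousOfDegree f m) : loopProjection k v f ∈ letterSpan k (v ⟶ v) ^ m := by
  induction hf using Submodule.span_induction with
  | mem x hx =>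
    obtain ⟨i, j, p, rfl, rfl⟩ := hx
    rw [loopProjection_ofPath]
    exact loopWord_mem p
  | zero => simp
  | add x y _ _ hx hy => rw [map_add]; exact add_mem hx hy
  | smul c x _ hx => rw [map_smul]; exact Submodule.smul_mem _ _ hx

theorem IsHomogeneousOfDegree.pathDeriv {f : PathAlgebra k V} {m : ℕ}
    (hf : IsHomogeneousOfDegree f (m + 1)) {i j : V} (a : i ⟶ j) :
    IsHomogeneousOfDegree (pathDeriv a f) m := by
  unfold IsHomogeneousOfDegree at *
  induction hf using Submodule.span_induction with
  | mem x hx =>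
    obtain ⟨i', j', p, hp, rfl⟩ := hx
    rw [_root_.pathDeriv, PathAlgebra.basis_constr_ofPath]
    split_ifs with h
    · refine Submodule.subset_span ⟨_, _, _, ?_, rfl⟩
      have := congrArg (fun x : AllPaths V => x.2.2.length) h.choose_spec.choose_spec
      simp only [hp, Path.length_comp, Path.length_toPath] at this
      omega
    · exact zero_mem _
  | zero => simp
  | add x y _ _ hx hy => rw [map_add]; exact add_mem hx hy
  | smul c x _ hx => rw [map_smul]; exact Submodule.smul_mem _ _ hx

variable (k v) in
/-- The character of the path algebra at the vertex `v`: it kills all arrows, and all trivial paths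
except for the one at `v`. -/
def pathCharacter : PathAlgebra k V →ₐ[k] k :=
  (wordAugmentation k (v ⟶ v)).comp (loopProjection k v)

theorem pathCharacter_ofPath_of_length_ne_zero {i j : V} (p : Path i j) (hp : p.length ≠ 0) :
    pathCharacter k v (PathAlgebra.ofPath p) = 0 := by
  rw [pathCharacter, AlgHom.comp_apply, loopProjection_ofPath]
  exact wordAugmentation_of_mem_pow hp (loopWord_mem p)

theorem pathCharacter_e_self : pathCharacter k v (PathAlgebra.e v) = 1 := by
  rw [pathCharacter, AlgHom.comp_apply, PathAlgebra.e, loopProjection_ofPath, loopWord, if_pos rfl,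
    map_one]

theorem pathCharacter_ofPath_of_left_ne {i j : V} (p : Path i j) (hi : i ≠ v) :
    pathCharacter k v (PathAlgebra.ofPath p) = 0 := by
  rw [← Path.nil_comp p, ← PathAlgebra.ofPath_mul_ofPath, map_mul, pathCharacter,
    AlgHom.comp_apply, loopProjection_ofPath, loopWord, if_neg hi, map_zero, zero_mul]

theorem pathCharacter_ofPath_of_right_ne {i j : V} (p : Path i j) (hj : j ≠ v) :
    pathCharacter k v (PathAlgebra.ofPath p) = 0 := by
  rw [← Path.comp_nil p, ← PathAlgebra.ofPath_mul_ofPath, map_mul]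
  simp only [pathCharacter]
  rw [AlgHom.comp_apply _ _ (PathAlgebra.ofPath Path.nil), loopProjection_ofPath, loopWord,
    if_neg hj, map_zero, mul_zero]

theorem IsHomogeneousOfDegree.pathCharacter_eq_zero {f : PathAlgebra k V} {m : ℕ}
    (hf : IsHomogeneousOfDegree f m) (hm : m ≠ 0) : pathCharacter k v f = 0 :=
  wordAugmentation_of_mem_pow hm hf.loopProjection_mem

theorem IsHomogeneousOfDegree.decomposable {f : PathAlgebra k V} {m : ℕ}
    (hf : IsHomogeneousOfDegree f m) (hm : 2 ≤ m) :
    f ∈ Submodule.span k {z | ∃ x y : PathAlgebra k V,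
      pathCharacter k v x = 0 ∧ pathCharacter k v y = 0 ∧ z = x * y} := by
  refine Submodule.span_mono ?_ hf
  rintro _ ⟨i, j, p, rfl, rfl⟩
  cases p with
  | nil => simp at hm
  | cons p a =>
    rw [Path.length_cons] at hm
    refine ⟨PathAlgebra.ofPath p, PathAlgebra.ofArrow a,
      pathCharacter_ofPath_of_length_ne_zero p (by omega),
      pathCharacter_ofPath_of_length_ne_zero _ (by simp), ?_⟩
    rw [PathAlgebra.ofArrow, PathAlgebra.ofPath_mul_ofPath]
    rfl

end Loops

/-! ### The relations at a vertex -/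

section VertexRelations

variable {k V : Type*} [Field k] [Quiver V] [Fintype V]

/-- The quotient map from the path algebra to the derivation-quotient algebra. -/
def derivationQuotientMap (ω : PathAlgebra k V) : PathAlgebra k V →ₐ[k] DerivationQuotient ω :=
  (derivationIdeal ω).ringCon.mkₐ k

theorem derivationQuotientMap_surjective (ω : PathAlgebra k V) :
    Function.Surjective (derivationQuotientMap ω) :=
  RingCon.mkₐ_surjective _

theorem derivationQuotientMap_eq_zero_iff {ω x : PathAlgebra k V} :
    derivationQuotientMap ω x = 0 ↔ x ∈ derivationIdeal ω := by
  rw [TwoSidedIdeal.mem_iff]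
  exact (derivationIdeal ω).ringCon.eq

theorem derivationQuotientMap_pathDeriv (ω : PathAlgebra k V) {i j : V} (a : i ⟶ j) :
    derivationQuotientMap ω (pathDeriv a ω) = 0 :=
  derivationQuotientMap_eq_zero_iff.mpr (TwoSidedIdeal.subset_span ⟨i, j, a, rfl⟩)

variable {ω : PathAlgebra k V} {c : ℕ} {v : V}

variable (ω v) in
/-- The relations `∂_a ω`, read in the free algebra on the loops at `v`. -/
def vertexRelations : Submodule k (WordAlgebra k (v ⟶ v)) :=
  Submodule.span k {x | ∃ (i j : V) (a : i ⟶ j), x = loopProjection k v (pathDeriv a ω)}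

theorem vertexRelations_le (hω : IsHomogeneousOfDegree ω (c + 2)) :
    vertexRelations ω v ≤ letterSpan k (v ⟶ v) ^ (c + 1) := by
  refine Submodule.span_le.mpr ?_
  rintro _ ⟨i, j, a, rfl⟩
  exact (hω.pathDeriv a).loopProjection_mem

theorem loopProjection_mem_wordIdeal {x : PathAlgebra k V} (hx : derivationQuotientMap ω x = 0) :
    loopProjection k v x ∈ wordIdeal (vertexRelations ω v) c := by
  rw [derivationQuotientMap_eq_zero_iff] at hx
  induction hx using TwoSidedIdeal.span_induction with
  | mem x hx =>
    obtain ⟨i, j, a, rfl⟩ := hx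
    exact le_wordIdeal (Submodule.subset_span ⟨i, j, a, rfl⟩)
  | zero => rw [map_zero]; exact zero_mem _
  | add x y _ _ hx hy => rw [map_add]; exact add_mem hx hy
  | neg x _ hx => rw [map_neg]; exact neg_mem hx
  | left_absorb a x _ hx => rw [map_mul]; exact (mul_mem_wordIdeal _ hx).1
  | right_absorb b x _ hx => rw [map_mul]; exact (mul_mem_wordIdeal _ hx).2

theorem exists_vertexCharacter (v : V) (hω : IsHomogeneousOfDegree ω (c + 2)) :
    ∃ ε : DerivationQuotient ω →ₐ[k] k,
      ∀ x, ε (derivationQuotientMap ω x) = pathCharacter k v x := by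
  have h0 : ∀ x ∈ derivationIdeal ω, pathCharacter k v x = 0 := by
    intro x hx
    induction hx using TwoSidedIdeal.span_induction with
    | mem x hx =>
      obtain ⟨i, j, a, rfl⟩ := hx
      exact (hω.pathDeriv a).pathCharacter_eq_zero (Nat.succ_ne_zero c)
    | zero => rw [map_zero]
    | add x y _ _ hx hy => rw [map_add, hx, hy, add_zero]
    | neg x _ hx => rw [map_neg, hx, neg_zero]
    | left_absorb a x _ hx => rw [map_mul, hx, mul_zero]
    | right_absorb b x _ hx => rw [map_mul, hx, zero_mul]
  refine ⟨(derivationIdeal ω).ringCon.liftₐ (pathCharacter k v) ?_,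
    fun x => RingCon.liftₐ_mk _ _ _ x⟩
  intro x y hxy
  rw [TwoSidedIdeal.rel_iff] at hxy
  exact sub_eq_zero.mp ((map_sub (pathCharacter k v) x y).symm.trans (h0 _ hxy))

/-- The relations at `v` inject, up to duality, into `Ext²` with coefficients in the simple bimodule
at `v`: a functional on them extends to a functional on the path algebra, by way of the projection
to the degree of the relations. -/
theorem finrank_vertexRelations_le.{u, v', w} {k : Type u} {V : Type v'} [Field k]
    [Quiver.{w} V] [Fintype V] [∀ i j : V, Finite (i ⟶ j)]
    {ω : PathAlgebra k V} {c : ℕ} {v : V} (hc : c ≠ 0) (hω : IsHomogeneousOfDegree ω (c + 2))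
    {ε : DerivationQuotient ω →ₐ[k] k}
    (hε : ∀ x, ε (derivationQuotientMap ω x) = pathCharacter k v x)
    [Module.Finite k (Abelian.Ext.{max u v' w} (diagonalBimodule k (DerivationQuotient ω))
      (characterModule ε) 2)] :
    Module.finrank k (vertexRelations ω v) ≤
      Module.finrank k (Abelian.Ext.{max u v' w} (diagonalBimodule k (DerivationQuotient ω))
        (characterModule ε) 2) := by
  obtain ⟨C, hC⟩ := exists_relationClass (derivationQuotientMap_surjective ω) ε
  have hR := vertexRelations_le (v := v) hω
  obtain ⟨s, hs⟩ := LinearMap.exists_leftInverse_of_injective (vertexRelations ω v).subtype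
    (Submodule.ker_subtype _)
  set τ : PathAlgebra k V →ₗ[k] vertexRelations ω v :=
    s ∘ₗ degreePart k (v ⟶ v) (c + 1) ∘ₗ (loopProjection k v).toLinearMap with hτ
  have hmem : ∀ g : Module.Dual k (vertexRelations ω v),
      g ∘ₗ τ ∈ bimoduleFunctionals (derivationQuotientMap ω) ε := by
    intro g x j hj
    have h := degreePart_mul hR (loopProjection k v x)
      (loopProjection_mem_wordIdeal (v := v) (c := c) hj)
    rw [hε]
    simp only [hτ, LinearMap.comp_apply, AlgHom.toLinearMap_apply, map_mul, h.1, h.2, map_smul,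
      smul_eq_mul]
    exact ⟨rfl, mul_comm _ _⟩
  let Ψ : Module.Dual k (vertexRelations ω v) →ₗ[k]
      bimoduleFunctionals (derivationQuotientMap ω) ε :=
    LinearMap.codRestrict _ (LinearMap.lcomp k k τ) hmem
  have hinj : Function.Injective (C ∘ₗ Ψ) := by
    rw [← LinearMap.ker_eq_bot, LinearMap.ker_eq_bot']
    intro g hg
    have key := hC (Ψ g) hg
    refine LinearMap.ext fun ⟨x, hx⟩ => ?_
    change g ⟨x, hx⟩ = 0
    induction hx using Submodule.span_induction with
    | mem x hx =>
      obtain ⟨i, j, a, rfl⟩ := hx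
      have h1 := key (pathDeriv a ω) (derivationQuotientMap_pathDeriv ω a) (by
        simp only [hε]
        exact (hω.pathDeriv a).decomposable (by omega))
      have h2 : τ (pathDeriv a ω) = ⟨_, Submodule.subset_span ⟨i, j, a, rfl⟩⟩ := by
        simp only [hτ, LinearMap.comp_apply, AlgHom.toLinearMap_apply]
        rw [degreePart_of_mem (hω.pathDeriv a).loopProjection_mem, if_pos rfl]
        exact LinearMap.congr_fun hs ⟨_, Submodule.subset_span ⟨i, j, a, rfl⟩⟩
      rw [← h2]
      exact h1
    | zero => exact map_zero g
    | add x y hx hy ihx ihy =>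
      exact (map_add g ⟨x, hx⟩ ⟨y, hy⟩).trans (by rw [ihx, ihy, add_zero])
    | smul r x hx ih =>
      exact (map_smul g r ⟨x, hx⟩).trans (by rw [ih, smul_zero])
  have : FiniteDimensional k (vertexRelations ω v) :=
    have : FiniteDimensional k (letterSpan k (v ⟶ v) ^ (c + 1) : Submodule k _) :=
      Module.Finite.of_fg ((Module.Finite.iff_fg.mp inferInstance).pow _)
    Submodule.finiteDimensional_of_le hR
  rw [← Subspace.dual_finrank_eq]
  exact LinearMap.finrank_le_finrank_of_injective hinj

end VertexRelations

/-! ### Calabi–Yau duality at a vertex -/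

section VertexDuality

theorem PathAlgebra.e_mul_e_self {k V : Type*} [Field k] [Quiver V] (i : V) :
    (e i * e i : PathAlgebra k V) = e i := by
  rw [e, ofPath_mul_ofPath, Path.comp_nil]

variable {k V : Type*} [Field k] [Quiver V] [Fintype V] {ω : PathAlgebra k V} {v : V}

/-- The kernel of the character at `v` is generated, as a left ideal, by `1 - e_v` and the arrows
that end at `v`. -/
theorem sub_pathCharacter_mem_span {S : Set (DerivationQuotient ω)}
    (he : 1 - derivationQuotientMap ω (PathAlgebra.e v) ∈ S)
    (ha : ∀ (i : V) (a : i ⟶ v), derivationQuotientMap ω (PathAlgebra.ofArrow a) ∈ S)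
    (y : PathAlgebra k V) :
    derivationQuotientMap ω y - algebraMap k _ (pathCharacter k v y) ∈
      Submodule.span (DerivationQuotient ω) S := by
  induction y using PathAlgebra.induction_on with
  | h0 => simp
  | hadd f g hf hg =>
    rw [map_add, map_add, map_add, add_sub_add_comm]
    exact add_mem hf hg
  | hsmul c f hf =>
    rw [map_smul, map_smul, smul_eq_mul, map_mul, Algebra.smul_def, ← mul_sub]
    exact Submodule.smul_mem _ _ hf
  | hp i j p =>
    by_cases hj : j = v
    · subst hj
      cases p with
      | nil =>
        have h := pathCharacter_e_self (k := k) (v := i)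
        rw [PathAlgebra.e] at h he
        rw [h, map_one, ← neg_sub]
        exact neg_mem (Submodule.subset_span he)
      | cons p a =>
        rw [pathCharacter_ofPath_of_length_ne_zero _ (by simp), map_zero, sub_zero]
        have h : PathAlgebra.ofPath (p.cons a) = PathAlgebra.ofPath p * (PathAlgebra.ofArrow a :
            PathAlgebra k V) := by
          rw [PathAlgebra.ofArrow, PathAlgebra.ofPath_mul_ofPath]; rfl
        rw [h, map_mul]
        exact Submodule.smul_mem _ _ (Submodule.subset_span (ha _ a))
    · rw [pathCharacter_ofPath_of_right_ne p hj, map_zero, sub_zero]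
      have h := Submodule.smul_mem (Submodule.span (DerivationQuotient ω) S)
        (derivationQuotientMap ω (PathAlgebra.ofPath p)) (Submodule.subset_span he)
      rwa [smul_eq_mul, mul_sub, mul_one, ← map_mul, PathAlgebra.e,
        PathAlgebra.ofPath_mul_ofPath_of_ne _ _ hj, map_zero, sub_zero] at h

/-- The kernel of the character at `v` is generated, as a right ideal, by `1 - e_v` and the arrows
that start at `v`. -/
theorem sub_pathCharacter_mem_span_op {S : Set (DerivationQuotient ω)}
    (he : 1 - derivationQuotientMap ω (PathAlgebra.e v) ∈ S)
    (ha : ∀ (j : V) (a : v ⟶ j), derivationQuotientMap ω (PathAlgebra.ofArrow a) ∈ S)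
    (y : PathAlgebra k V) :
    derivationQuotientMap ω y - algebraMap k _ (pathCharacter k v y) ∈
      Submodule.span (DerivationQuotient ω)ᵐᵒᵖ S := by
  induction y using PathAlgebra.induction_on with
  | h0 => simp
  | hadd f g hf hg =>
    rw [map_add, map_add, map_add, add_sub_add_comm]
    exact add_mem hf hg
  | hsmul c f hf =>
    rw [map_smul, map_smul, smul_eq_mul, map_mul, Algebra.smul_def, ← mul_sub,
      Algebra.commutes]
    exact Submodule.smul_mem _ (MulOpposite.op (algebraMap k (DerivationQuotient ω) c)) hf
  | hp i j p =>
    by_cases hi : i = v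
    · subst hi
      by_cases hp : p.length = 0
      · obtain rfl := Path.eq_of_length_zero p hp
        obtain rfl := Path.eq_nil_of_length_zero p hp
        have h := pathCharacter_e_self (k := k) (v := i)
        rw [PathAlgebra.e] at h he
        rw [h, map_one, ← neg_sub]
        exact neg_mem (Submodule.subset_span he)
      · rw [pathCharacter_ofPath_of_length_ne_zero _ hp, map_zero, sub_zero]
        obtain ⟨l, a, q, rfl, _⟩ := (Path.length_ne_zero_iff_eq_comp p).mp hp
        rw [← PathAlgebra.ofPath_mul_ofPath, map_mul]
        exact Submodule.smul_mem _ (MulOpposite.op (derivationQuotientMap ω (PathAlgebra.ofPath q)))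
          (Submodule.subset_span (ha _ a))
    · rw [pathCharacter_ofPath_of_left_ne p hi, map_zero, sub_zero]
      have h := Submodule.smul_mem (Submodule.span (DerivationQuotient ω)ᵐᵒᵖ S)
        (MulOpposite.op (derivationQuotientMap ω (PathAlgebra.ofPath p)))
        (Submodule.subset_span he)
      rwa [op_smul_eq_mul, sub_mul, one_mul, ← map_mul, PathAlgebra.e,
        PathAlgebra.ofPath_mul_ofPath_of_ne _ _ (Ne.symm hi), map_zero, sub_zero] at h

/-- Duality bounds the number of relations at `v` by the number of loops at `v`. The vertices other
than `v` do not contribute, since `μ` sends their trivial paths into the kernel of the character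
at `v`. -/
theorem IsTwistedCalabiYau.finrank_vertexRelations_le [∀ i j : V, Finite (i ⟶ j)] {c : ℕ}
    (hc : c ≠ 0) (hω : IsHomogeneousOfDegree ω (c + 2))
    {μ : DerivationQuotient ω ≃ₐ[k] DerivationQuotient ω} (hCY : IsTwistedCalabiYau k 3 μ)
    (hv : μ (DerivationQuotient.e ω v) = DerivationQuotient.e ω v) :
    Module.finrank k (vertexRelations ω v) ≤ Nat.card (v ⟶ v) := by
  obtain ⟨ε, hε⟩ := exists_vertexCharacter v hω
  set π := derivationQuotientMap ω with hπ
  have hv' : μ (π (PathAlgebra.e v)) = π (PathAlgebra.e v) := hv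
  have hεv : ε (π (PathAlgebra.e v)) = 1 := by rw [hε, pathCharacter_e_self]
  have hε1 : ε (1 - π (PathAlgebra.e v)) = 0 := by rw [map_sub, map_one, hεv, sub_self]
  have hεa : ∀ (i j : V) (a : i ⟶ j), ε (π (PathAlgebra.ofArrow a)) = 0 := fun i j a => by
    rw [hε, PathAlgebra.ofArrow, pathCharacter_ofPath_of_length_ne_zero _ (by simp)]
  set L₀ : Set (DerivationQuotient ω) := insert (1 - π (PathAlgebra.e v))
    (Set.range fun x : Σ i : {i : V // i ≠ v}, ((i : V) ⟶ v) =>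
      π (PathAlgebra.ofArrow x.2)) with hL₀
  set L₁ : Set (DerivationQuotient ω) :=
    Set.range fun a : v ⟶ v => π (PathAlgebra.ofArrow a) with hL₁
  set S : Set (DerivationQuotient ω) := insert (1 - π (PathAlgebra.e v))
    (Set.range fun x : Σ j : V, (v ⟶ j) => π (PathAlgebra.ofArrow x.2)) with hS
  obtain ⟨hfin, hle⟩ := hCY.finrank_ext_le (m := 2) ε (L₀ := L₀) (L₁ := L₁) (R := S)
    ((Set.finite_range _).insert _) (Set.finite_range _) ((Set.finite_range _).insert _)
    (by
      rintro _ (rfl | ⟨x, rfl⟩)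
      · exact hε1
      · exact hεa _ _ _)
    (by
      rintro _ ⟨a, rfl⟩
      exact hεa _ _ _)
    (by
      rintro _ (rfl | ⟨x, rfl⟩)
      · exact hε1
      · exact hεa _ _ _)
    (by
      intro x hx
      obtain ⟨y, rfl⟩ := derivationQuotientMap_surjective ω x
      have h := sub_pathCharacter_mem_span (v := v) (S := L₀ ∪ L₁) (Or.inl (Or.inl rfl)) (by
        intro i a
        by_cases hi : i = v
        · subst hi
          exact Or.inr ⟨a, rfl⟩
        · exact Or.inl (Or.inr ⟨⟨⟨i, hi⟩, a⟩, rfl⟩)) y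
      rwa [← hε, hx, map_zero, sub_zero] at h)
    (by
      intro x hx
      obtain ⟨y, rfl⟩ := derivationQuotientMap_surjective ω x
      have h := sub_pathCharacter_mem_span_op (v := v) (S := S) (Or.inl rfl)
        (fun j a => Or.inr ⟨⟨j, a⟩, rfl⟩) y
      rwa [← hε, hx, map_zero, sub_zero] at h)
    (by
      rintro _ (rfl | ⟨⟨⟨i, hi⟩, a⟩, rfl⟩)
      · refine ⟨1 - π (PathAlgebra.e v), ?_, ?_⟩
        · rw [mul_sub, mul_one, sub_mul, one_mul, ← map_mul, PathAlgebra.e_mul_e_self, sub_self,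
            sub_zero]
        · rw [map_sub, map_one, hv', hε1]
      · refine ⟨π (PathAlgebra.e i), ?_, ?_⟩
        · rw [← map_mul, PathAlgebra.e, PathAlgebra.ofArrow, PathAlgebra.ofPath_mul_ofPath,
            Path.nil_comp]
          rfl
        · -- `e_i e_v = 0`, and `μ` fixes `e_v`, on which the character is `1`.
          have h : ε (μ (π (PathAlgebra.e i * PathAlgebra.e v))) = 0 := by
            rw [PathAlgebra.e, PathAlgebra.e, PathAlgebra.ofPath_mul_ofPath_of_ne _ _ hi]
            simp only [map_zero]
          rwa [map_mul, map_mul, map_mul, hv', hεv, mul_one] at h)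
  have := hfin
  refine (_root_.finrank_vertexRelations_le hc hω hε).trans (hle.trans ?_)
  rw [hL₁, ← Set.image_univ, ← Set.ncard_univ]
  exact Set.ncard_image_le Set.finite_univ

end VertexDuality

/-! ### Exponential growth -/

section Growth

/-- If `f` vanishes only where `g` takes values in `I`, then the image of `g` is at most `dim I`
larger than that of `f`. -/
theorem finrank_map_le_finrank_map_add {k E F G : Type*} [Field k] [AddCommGroup E] [Module k E]
    [AddCommGroup F] [Module k F] [AddCommGroup G] [Module k G] (f : E →ₗ[k] F) (g : E →ₗ[k] G)
    (U : Submodule k E) [FiniteDimensional k U] (I : Submodule k G) [FiniteDimensional k I]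
    (h : ∀ u ∈ U, f u = 0 → g u ∈ I) :
    Module.finrank k (U.map g) ≤ Module.finrank k (U.map f) + Module.finrank k I := by
  obtain ⟨C, hC⟩ := (LinearMap.ker (f.domRestrict U)).exists_isCompl
  have h1 : U.map g ≤ C.map (g.domRestrict U) ⊔ I := by
    rintro _ ⟨u, hu, rfl⟩
    obtain ⟨x, hx, y, hy, hxy⟩ := Submodule.mem_sup.mp
      (hC.sup_eq_top.symm ▸ Submodule.mem_top : (⟨u, hu⟩ : U) ∈ LinearMap.ker (f.domRestrict U) ⊔ C)
    have h2 : g u = g y + g x := by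
      rw [← map_add, add_comm, ← Submodule.coe_add, hxy]
    rw [h2]
    exact Submodule.add_mem_sup ⟨y, hy, rfl⟩ (h x x.2 hx)
  have h2 : Module.finrank k C = Module.finrank k (U.map f) := by
    have h3 := LinearMap.finrank_range_add_finrank_ker (f.domRestrict U)
    rw [LinearMap.range_domRestrict] at h3
    have h4 := Submodule.finrank_add_eq_of_isCompl hC
    omega
  calc Module.finrank k (U.map g) ≤ _ := Submodule.finrank_mono h1
    _ ≤ _ := Submodule.finrank_add_le_finrank_add_finrank _ _
    _ ≤ _ := Nat.add_le_add_right ((Submodule.finrank_map_le _ C).trans h2.le) _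

theorem tendsto_natCast_div_log_atTop :
    Filter.Tendsto (fun m : ℕ => (m : ℝ) / Real.log m) Filter.atTop Filter.atTop := by
  have h1 : Filter.Tendsto (fun x : ℝ => Real.log x / x) Filter.atTop
      (nhdsWithin 0 (Set.Ioi 0)) := by
    refine tendsto_nhdsWithin_iff.mpr ⟨Real.isLittleO_log_id_atTop.tendsto_div_nhds_zero, ?_⟩
    filter_upwards [Filter.eventually_gt_atTop 1] with x hx
    exact div_pos (Real.log_pos hx) (by linarith)
  have h2 := h1.inv_tendsto_nhdsGT_zero.comp tendsto_natCast_atTop_atTop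
  refine h2.congr fun m => ?_
  simp

/-- Exponential growth makes the Gelfand-Kirillov dimension infinite. -/
theorem gkDim_eq_top {k A : Type*} [Field k] [Ring A] [Algebra k A] (W : Submodule k A)
    [FiniteDimensional k W] {r : ℝ} (hr : 1 < r)
    (h : ∀ m, r ^ m ≤ Module.finrank k (W ^ m : Submodule k A)) : gkDim k A = ⊤ := by
  have hpow : ∀ m, FiniteDimensional k (W ^ m : Submodule k A) := fun m =>
    Module.Finite.of_fg ((Module.Finite.iff_fg.mp ‹_›).pow m)
  have hsum : ∀ s : Finset ℕ, FiniteDimensional k (∑ i ∈ s, W ^ i : Submodule k A) := fun s =>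
    Finset.sum_induction _ (fun U : Submodule k A => FiniteDimensional k U)
      (fun U U' _ _ => inferInstanceAs (FiniteDimensional k (U ⊔ U' : Submodule k A)))
      (inferInstanceAs (FiniteDimensional k (⊥ : Submodule k A))) fun m _ => hpow m
  refine top_le_iff.mp (le_trans ?_ (le_iSup₂ (f := fun (W : Submodule k A)
    (_ : FiniteDimensional k W) => _) W ‹_›))
  refine le_of_eq (Filter.Tendsto.limsup_eq ?_).symm
  rw [EReal.tendsto_coe_nhds_top_iff]
  refine Filter.tendsto_atTop_mono' _ ?_
    (tendsto_natCast_div_log_atTop.const_mul_atTop (Real.log_pos hr))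
  filter_upwards [Filter.eventually_gt_atTop 1] with m hm
  rw [← mul_div_assoc]
  have hlog : 0 < Real.log m := Real.log_pos (by exact_mod_cast hm)
  refine div_le_div_of_nonneg_right ?_ hlog.le
  rw [mul_comm, ← Real.log_pow]
  refine Real.log_le_log (pow_pos (by linarith) m) ((h m).trans ?_)
  have hle : W ^ m ≤ ∑ i ∈ Finset.range (m + 1), W ^ i := by
    rw [Finset.sum_range_succ]
    exact le_sup_right
  exact_mod_cast Submodule.finrank_mono hle

variable {k V : Type*} [Field k] [Quiver V] [Fintype V] [∀ i j : V, Finite (i ⟶ j)]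

/-- If the number of relations at `v` is at most the number `n` of loops, and the recurrence of
Golod and Shafarevich has growth rate `r > 1`, then the loops generate a subalgebra of exponential
growth. -/
theorem gkDim_derivationQuotient_eq_top {ω : PathAlgebra k V} {c : ℕ} {v : V}
    (hω : IsHomogeneousOfDegree ω (c + 2))
    (hrel : Module.finrank k (vertexRelations ω v) ≤ Nat.card (v ⟶ v)) {r : ℝ} (hr : 1 < r)
    (hrn : r ≤ Nat.card (v ⟶ v))
    (hn : r ^ (c + 1) + Nat.card (v ⟶ v) ≤ Nat.card (v ⟶ v) * r ^ c) :
    gkDim k (DerivationQuotient ω) = ⊤ := by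
  set U : Submodule k (PathAlgebra k V) :=
    Submodule.span k (Set.range fun a : v ⟶ v => PathAlgebra.ofArrow a) with hU
  have hUfin : FiniteDimensional k U := FiniteDimensional.span_of_finite k (Set.finite_range _)
  have hUV : U.map (loopProjection k v).toLinearMap = letterSpan k (v ⟶ v) := by
    rw [hU, Submodule.map_span, letterSpan, ← Set.range_comp]
    congr 2
    funext a
    exact loopProjection_ofArrow a
  have hR := vertexRelations_le (v := v) hω
  refine gkDim_eq_top (U.map (derivationQuotientMap ω).toLinearMap) hr fun m => ?_
  have hUm : FiniteDimensional k (U ^ m : Submodule k _) :=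
    Module.Finite.of_fg ((Module.Finite.iff_fg.mp hUfin).pow m)
  have hVm : FiniteDimensional k (letterSpan k (v ⟶ v) ^ m : Submodule k _) :=
    Module.Finite.of_fg ((Module.Finite.iff_fg.mp inferInstance).pow m)
  have hI : FiniteDimensional k (relationIdeal (letterSpan k (v ⟶ v)) (vertexRelations ω v) c m) :=
    Submodule.finiteDimensional_of_le (relationIdeal_le_pow hR m)
  have hmap : (U ^ m).map (loopProjection k v).toLinearMap = letterSpan k (v ⟶ v) ^ m := by
    rw [Submodule.map_pow, hUV]
  have h1 := finrank_map_le_finrank_map_add (derivationQuotientMap ω).toLinearMap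
    (loopProjection k v).toLinearMap (U ^ m)
    (relationIdeal (letterSpan k (v ⟶ v)) (vertexRelations ω v) c m) (by
      intro u hu h0
      have h2 := degreePart_mem_relationIdeal hR (loopProjection_mem_wordIdeal (v := v) h0) m
      have h3 : loopProjection k v u ∈ letterSpan k (v ⟶ v) ^ m := hmap ▸ ⟨u, hu, rfl⟩
      rwa [degreePart_of_mem h3, if_pos rfl] at h2)
  rw [hmap, finrank_letterSpan_pow, Submodule.map_pow] at h1
  have h2 := pow_le_sub_finrank_relationIdeal (finrank_letterSpan_pow k (v ⟶ v)) hR hrel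
    (by linarith) hrn hn m
  have h3 : (Nat.card (v ⟶ v) : ℝ) ^ m ≤ Module.finrank k
      (U.map (derivationQuotientMap ω).toLinearMap ^ m : Submodule k _) +
      Module.finrank k (relationIdeal (letterSpan k (v ⟶ v)) (vertexRelations ω v) c m) := by
    exact_mod_cast h1
  linarith

end Growth

/-- For more than `ℓ(d)` loops, the recurrence of Golod and Shafarevich has a growth rate above `1`.
Any number between the two positive roots of `r ^ (d - 1) - n r ^ (d - 2) + n` will do. -/
theorem exists_growth_rate {c n : ℕ} (hc : c ≠ 0) (hn : loopBound (c + 2) < n) :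
    ∃ r : ℝ, 1 < r ∧ r ≤ n ∧ r ^ (c + 1) + n ≤ n * r ^ c := by
  obtain rfl | rfl | rfl | h4 : c = 1 ∨ c = 2 ∨ c = 3 ∨ 4 ≤ c := by omega
  · have h : (4 : ℝ) ≤ n := by exact_mod_cast hn
    exact ⟨2, by norm_num, by linarith, by norm_num; linarith⟩
  · have h : (3 : ℝ) ≤ n := by exact_mod_cast hn
    exact ⟨2, by norm_num, by linarith, by norm_num; linarith⟩
  · have h : (3 : ℝ) ≤ n := by exact_mod_cast hn
    exact ⟨2, by norm_num, by linarith, by norm_num; linarith⟩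
  · have h : (2 : ℝ) ≤ n := by
      have : loopBound (c + 2) = 1 := by unfold loopBound; split_ifs <;> omega
      exact_mod_cast this ▸ hn
    refine ⟨5 / 3, by norm_num, by linarith, ?_⟩
    -- The claim is `(5/3)^c ≥ n / (n - 5/3)`, and the right side is at most `6` for `n ≥ 2`.
    have hp : (6 : ℝ) ≤ (5 / 3) ^ c :=
      le_trans (by norm_num) (pow_le_pow_right₀ (by norm_num : (1 : ℝ) ≤ 5 / 3) h4)
    rw [pow_succ]
    nlinarith

theorem proposition3p6 {k V : Type*} [Field k] [IsAlgClosed k] [CharZero k]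
    [Fintype V] [Quiver V] [∀ i j : V, Finite (i ⟶ j)]
    (d : ℕ) (hd : 3 ≤ d)
    (σ : PathAlgebra k V ≃ₐ[k] PathAlgebra k V) (ω : PathAlgebra k V)
    (hω : IsTwistedSuperpotential σ ω d)
    (μ : DerivationQuotient ω ≃ₐ[k] DerivationQuotient ω)
    (hCY : IsTwistedCalabiYau k 3 μ)
    (hGK : gkDim k (DerivationQuotient ω) < ⊤)
    (v : V) (hv : μ (DerivationQuotient.e ω v) = DerivationQuotient.e ω v) :
    Nat.card (v ⟶ v) ≤ loopBound d := by
  obtain ⟨c, rfl⟩ := Nat.exists_eq_add_of_le' (show 2 ≤ d by omega)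
  have hc : c ≠ 0 := by omega
  by_contra! hlt
  obtain ⟨r, hr, hrn, hn⟩ := exists_growth_rate hc hlt
  exact hGK.ne (gkDim_derivationQuotient_eq_top hω.homogeneous
    (hCY.finrank_vertexRelations_le hc hω.homogeneous hv) hr hrn hn)

end
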